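/- Let $H\ge 1$ be an integer (the planning horizon), $\sigma_y^2\in\mathbb R$ and $\sigma_n^2>0$. Consider a zero-mean Gaussian process on a set $\mathcal S$ of input locations with covariance function $\sigma_{ss'}$ satisfying $\sigma_{ss}\le\sigma_y^2$ for all $s$. Measurements carry independent $\mathcal N(0,\sigma_n^2)$ noise. At a location $s$ an agent may execute any macro-action from a finite non-empty set $\mathcal A(s)\subseteq\mathcal S^\kappa$ (with $\kappa\ge1$ and $|\mathcal A(s)|\le A$ for all $s$), i.e. visit its $\kappa$ locations in turn and take a measurement at each. Data $d=\langle\mathbf s,\mathbf z\rangle$ consist of a non-empty vector $\mathbf s$ of visited locations, whose last entry $s_{\rm cur}(d)$ is the current location, and the vector $\mathbf z$ of measurements made there; $d\oplus\langle a,z\rangle$ denotes $d$ extended by the macro-action $a$ and its measurements $z\in\mathbb R^\kappa$. The Gaussian process posterior of the measurements at $a$ given $d$ is $p(\cdot\mid a,d)=\mathcal N(\mu_{a|d},\Sigma_{a|\mathbf s})$ with $$\mu_{a|d}=\Sigma_{a\mathbf s}\Sigma_{\mathbf s\mathbf s}^{-1}\mathbf z,\qquad \Sigma_{a|\mathbf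 s}=\Sigma_{aa}-\Sigma_{a\mathbf s}\Sigma_{\mathbf s\mathbf s}^{-1}\Sigma_{\mathbf sa},$$ where $\Sigma_{a\mathbf s}$, $\Sigma_{\mathbf sa}$ contain the prior covariances, and $\Sigma_{\mathbf s\mathbf s}$, $\Sigma_{aa}$ are the prior covariance matrices plus $\sigma_n^2I$. For $\beta\in\mathbb R$ put $$R(a,d)=\mathbf 1^\top\mu_{a|d}+\tfrac12\beta\log\det(I+\sigma_n^{-2}\Sigma_{a|\mathbf s}),$$ and, for $t=0,\dots,H-1$, with $V_H^*=0$, $$V_t^*(d)=\max_{a\in\mathcal A(s_{\rm cur}(d))}Q_t^*(a,d),\qquad Q_t^*(a,d)=R(a,d)+\mathbb E_{z\sim p(\cdot\mid a,d)}\big[V^*_{t+1}(d\oplus\langle a,z\rangle)\big].$$ The stochastic-sampling approximations are, with $\mathcal V_H=0$, $$\mathcal V_t(d)=\max_{a\in\mathcal A(s_{\rm cur}(d))}\mathcal Q_t(a,d),\qquad \mathcal Q_t(a,d)=R(a,d)+\frac1N\sum_{\ell=1}^N\mathcal V_{t+1}(d\oplus\langle a,z^\ell\rangle),$$ where at every node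 $d$ of the resulting search tree and for every available macro-action $a$ the vectors $z^1,\dots,z^N$ are, conditionally on the samples on the path from the root to that node, i.i.d. with law $p(\cdot\mid a,d)$. **Theorem.** Given $H,\sigma_y^2,\sigma_n^2$, there is a function $N_0$ with values $N_0(\kappa,A,\delta,\lambda)\in\{1,2,\dots\}$ such that the following holds. 1. For all integers $\kappa,A\ge1$, all $\delta\in(0,1)$, $\lambda>0$ and $N\ge N_0(\kappa,A,\delta,\lambda)$, every problem as above, every stage $t\in\{0,\dots,H-1\}$ and all data $d_t$: with probability at least $1-\delta$, $$|\mathcal Q_t(a,d_t)-Q_t^*(a,d_t)|\le\lambda H\quad\text{for all } a\in\mathcal A(s_{\rm cur}(d_t)).$$ 2. $N_0(\kappa,A,\delta,\lambda)=\mathcal O\!\left(\frac{\kappa^{2H}}{\lambda^2}\log\frac{\kappa A}{\delta\lambda}\right)$ in the following sense: for all $\lambda_{\max}$ and $r>1$ there is $C>0$, depending only on $H,\sigma_y^2,\sigma_n^2,\lambda_{\max},r$, such that $$N_0(\kappa,A,\delta,\lambda)\le C\,\frac{\kappa^{2H}}{\lambda^2}\log\frac{\kappa A}{\delta\lambda}$$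 for all integers $\kappa,A\ge1$, all $\delta\in(0,1)$ and all $\lambda\in(0,\lambda_{\max}]$ with $\frac{\kappa A}{\delta\lambda}\ge r$. -/

import Mathlib

open MeasureTheory ProbabilityTheory

namespace MacroGPO

/-- A macro-action Gaussian process optimization problem on the set `S` of input locations, with
macro-actions of length `κ`: the prior is a zero-mean Gaussian process with covariance function
`cov`, every measurement carries an independent `N(0, noiseVar)` noise, `actions s` is the finite
non-empty set of macro-actions available at the current location `s`, and `beta` is the weight of
the exploration term. -/
structure Model (S : Type*) (κ : ℕ) where
  /-- prior covariance function -/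
  cov : Matrix S S ℝ
  /-- a covariance function is symmetric, with positive semidefinite finite Gram matrices -/
  cov_posSemidef : cov.PosSemidef
  /-- noise variance -/
  noiseVar : ℝ
  noiseVar_pos : 0 < noiseVar
  /-- weight of the exploration term -/
  beta : ℝ
  /-- macro-actions available at a location -/
  actions : S → Finset (Fin κ → S)
  actions_nonempty : ∀ s, (actions s).Nonempty

/-- Observations (data): a non-empty vector of visited locations with the measurements made there,
in the order in which they were gathered. -/
structure History (S : Type*) where
  len : ℕ
  len_pos : 0 < len
  loc : Fin len → S
  obs : Fin len → ℝ

namespace History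

variable {S : Type*}

/-- The current location is the last visited one. -/
def current (d : History S) : S :=
  d.loc ⟨d.len - 1, Nat.sub_lt d.len_pos Nat.one_pos⟩

/-- The data after the macro-action `a` was executed and the measurements `y` were observed. -/
def extend {κ : ℕ} (d : History S) (a : Fin κ → S) (y : EuclideanSpace ℝ (Fin κ)) : History S where
  len := d.len + κ
  len_pos := Nat.add_pos_left d.len_pos κ
  loc := Fin.append d.loc a
  obs := Fin.append d.obs (fun i => y i)

end History

/-- A tree of samples. A node of the search tree is the list of pairs (macro-action, index of the
sample) that leads to it from the root, and `Z p a l` is the `l`-th of the `N` vectors that are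
drawn at the node `p` for the macro-action `a`. -/
abbrev SampleTree (S : Type*) (κ N : ℕ) : Type _ :=
  List ((Fin κ → S) × Fin N) → (Fin κ → S) → Fin N → EuclideanSpace ℝ (Fin κ)

/-- The data at the node `p` of the search tree with root `d` and samples `Z`. -/
def nodeData {S : Type*} {κ N : ℕ} :
    History S → SampleTree S κ N → List ((Fin κ → S) × Fin N) → History S
  | d, _, [] => d
  | d, Z, (a, l) :: p => nodeData (d.extend a (Z [] a l)) (fun q => Z ((a, l) :: q)) p

/-- The σ-algebra of the samples that lie on the path from the root to the node `p`. -/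
@[reducible] def pathSigma {S Ω : Type*} {κ N : ℕ} (Z : Ω → SampleTree S κ N)
    (p : List ((Fin κ → S) × Fin N)) : MeasurableSpace Ω :=
  ⨆ (q : List ((Fin κ → S) × Fin N)) (b : Fin κ → S) (j : Fin N) (_ : q ++ [(b, j)] <+: p),
    MeasurableSpace.comap (fun ω => Z ω q b j) inferInstance

namespace Model

noncomputable section

variable {S : Type*} {κ : ℕ} (M : Model S κ)

/-- Covariance matrix of the noisy measurements at `s`; distinct measurements have independent
noise, also when they are made at the same location. -/
def noisyCov {n : ℕ} (s : Fin n → S) : Matrix (Fin n) (Fin n) ℝ :=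
  M.cov.submatrix s s + M.noiseVar • (1 : Matrix (Fin n) (Fin n) ℝ)

/-- Covariance matrix between the outputs at `a` and at `s`. -/
def crossCov {m n : ℕ} (a : Fin m → S) (s : Fin n → S) : Matrix (Fin m) (Fin n) ℝ :=
  M.cov.submatrix a s

/-- Posterior mean vector of the measurements at `a`, given the data `d`. -/
def postMean (d : History S) (a : Fin κ → S) : EuclideanSpace ℝ (Fin κ) :=
  WithLp.toLp 2 ((M.crossCov a d.loc * (M.noisyCov d.loc)⁻¹).mulVec d.obs)

/-- Posterior covariance matrix of the measurements at `a`, given the data `d`. -/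
def postCov (d : History S) (a : Fin κ → S) : Matrix (Fin κ) (Fin κ) ℝ :=
  M.noisyCov a - M.crossCov a d.loc * (M.noisyCov d.loc)⁻¹ * M.crossCov d.loc a

/-- Gaussian posterior of the measurements at `a`, given the data `d`. -/
def posterior (d : History S) (a : Fin κ → S) : Measure (EuclideanSpace ℝ (Fin κ)) :=
  multivariateGaussian (M.postMean d a) (M.postCov d a)

/-- The reward `R(a, d)`. -/
def reward (d : History S) (a : Fin κ → S) : ℝ :=
  ∑ i, M.postMean d a i +
    1 / 2 * M.beta * Real.log (1 + M.noiseVar⁻¹ • M.postCov d a).det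

/-- The Bayes-optimal value `V*` of the data `d` when `m` stages remain. -/
def optV : ℕ → History S → ℝ
  | 0, _ => 0
  | m + 1, d => (M.actions d.current).sup' (M.actions_nonempty d.current) fun a =>
      M.reward d a + ∫ y, optV m (d.extend a y) ∂(M.posterior d a)

/-- The Bayes-optimal value `Q*` of the macro-action `a` for the data `d` when `m` stages remain
after the execution of `a`. -/
def optQ (m : ℕ) (d : History S) (a : Fin κ → S) : ℝ :=
  M.reward d a + ∫ y, M.optV m (d.extend a y) ∂(M.posterior d a)

/-- The stochastic-sampling approximation of `V*` that is computed from the tree `Z` of samples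
when `m` stages remain; the subtree of `Z` at the child `(a, l)` of the root is
`fun q => Z ((a, l) :: q)`. -/
def sampV {N : ℕ} : ℕ → History S → SampleTree S κ N → ℝ
  | 0, _, _ => 0
  | m + 1, d, Z => (M.actions d.current).sup' (M.actions_nonempty d.current) fun a =>
      M.reward d a +
        1 / (N : ℝ) * ∑ l : Fin N, sampV m (d.extend a (Z [] a l)) (fun q => Z ((a, l) :: q))

/-- The stochastic-sampling approximation of `Q*` when `m` stages remain after the execution
of `a`. -/
def sampQ {N : ℕ} (m : ℕ) (d : History S) (Z : SampleTree S κ N) (a : Fin κ → S) : ℝ :=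
  M.reward d a +
    1 / (N : ℝ) * ∑ l : Fin N, M.sampV m (d.extend a (Z [] a l)) (fun q => Z ((a, l) :: q))

/-- Bellman equation for `V*`. -/
theorem optV_succ (m : ℕ) (d : History S) : M.optV (m + 1) d =
    (M.actions d.current).sup' (M.actions_nonempty d.current) (M.optQ m d) := rfl

/-- Bellman equation for the stochastic-sampling approximation. -/
theorem sampV_succ {N : ℕ} (m : ℕ) (d : History S) (Z : SampleTree S κ N) : M.sampV (m + 1) d Z =
    (M.actions d.current).sup' (M.actions_nonempty d.current) (M.sampQ m d Z) := rfl

/-- The macro-actions in the list can be executed one after the other, starting from `d`; the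
measurements are irrelevant here, since availability depends on the current location only. -/
def Feasible : History S → List (Fin κ → S) → Prop
  | _, [] => True
  | d, a :: as => a ∈ M.actions d.current ∧ Feasible (d.extend a 0) as

/-- `Z` is a random tree of samples for planning over `m` stages from the data `d`: at every node
`p` of the search tree and for every macro-action `a` available there, the `N` vectors
`Z p a 1, …, Z p a N` are i.i.d. draws from the posterior given the data at that node. This is the
conditional law given the samples on the path from the root to `p`; nothing is assumed about the
joint law of samples on different branches or for different macro-actions. -/
structure IsSampling {Ω : Type*} [MeasurableSpace Ω] (P : Measure Ω) {N : ℕ} (m : ℕ)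
    (d : History S) (Z : Ω → SampleTree S κ N) : Prop where
  measurable : ∀ p a l, Measurable fun ω => Z ω p a l
  condLaw : ∀ (p : List ((Fin κ → S) × Fin N)) (a : Fin κ → S), p.length < m →
    M.Feasible d (p.map Prod.fst ++ [a]) →
    ∀ E : Set Ω, MeasurableSet[pathSigma Z p] E →
    ∀ B : Set (Fin N → EuclideanSpace ℝ (Fin κ)), MeasurableSet B →
      P (E ∩ {ω | Z ω p a ∈ B}) =
        ∫⁻ ω in E, Measure.pi (fun _ : Fin N => M.posterior (nodeData d (Z ω) p) a) B ∂P

end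

end Model

end MacroGPO

/-! Everything rests on one regularity fact: the optimal value depends on the measurements in a
Lipschitz way, with a constant that ignores how many measurements were made and what they were. The
right metric is not Euclidean. Displace the measurements `z` by `Σ w`, where `Σ` is their noisy
covariance, and charge the energy norm `√(wᵀ Σ w)`. The posterior mean at `a` then moves by the
cross covariance times `w`, which Cauchy–Schwarz bounds by the energy. After a macro-action, the
displacement of the extended data is the extended covariance applied to `w` padded with zeros, with
the same energy. Hence each stage adds only `κ√v`, and the constants grow linearly instead of
compounding (`energyLipschitz_optV`). Since the noise bounds `Σ` from below, this yields a Euclidean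
Lipschitz constant (`EnergyLipschitz.le_add_norm`).

A Lipschitz function of a Gaussian vector is sub-Gaussian (`LipschitzWith.hasSubgaussianMGF`), so at
any node the empirical mean of optimal child values has a Gaussian tail, uniformly in the data
there. A union bound over a tree with branching `A * N` makes all these means accurate at once
(`measure_not_accurate_le`). On that event the errors simply add over the levels
(`Accurate.abs_sampQ_sub_optQ_le`). Finally, half of the exponential decay absorbs the factor `(A *
N) ^ H`, which fixes the sample size (`pow_mul_exp_neg_le`). -/

namespace MacroGPO

open Matrix

variable {S : Type*} {κ : ℕ}

/-! ### Covariance matrices, and posteriors under displaced measurements -/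

/-- The data `d` with the measurements replaced by `z`. -/
def History.withObs (d : History S) (z : Fin d.len → ℝ) : History S :=
  ⟨d.len, d.len_pos, d.loc, z⟩

namespace Model

variable (M : Model S κ)

lemma cov_submatrix_posSemidef {ι : Type*} (s : ι → S) : (M.cov.submatrix s s).PosSemidef :=
  M.cov_posSemidef.submatrix s

lemma noisyCov_posDef {n : ℕ} (s : Fin n → S) : (M.noisyCov s).PosDef :=
  (Matrix.PosDef.one.smul M.noiseVar_pos).posSemidef_add (M.cov_submatrix_posSemidef s)

lemma cov_comm (x y : S) : M.cov x y = M.cov y x := by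
  have := M.cov_posSemidef.isHermitian.apply x y
  simpa using this.symm

lemma noiseVar_mul_dotProduct_le {n : ℕ} (s : Fin n → S) (w : Fin n → ℝ) :
    M.noiseVar * (w ⬝ᵥ w) ≤ w ⬝ᵥ M.noisyCov s *ᵥ w := by
  have h := (M.cov_submatrix_posSemidef s).dotProduct_mulVec_nonneg w
  simp only [star_trivial] at h
  simp only [noisyCov, add_mulVec, dotProduct_add, smul_mulVec, one_mulVec, dotProduct_smul,
    smul_eq_mul]
  linarith

lemma dotProduct_noisyCov_nonneg {n : ℕ} (s : Fin n → S) (w : Fin n → ℝ) :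
    0 ≤ w ⬝ᵥ M.noisyCov s *ᵥ w := by
  simpa using (M.noisyCov_posDef s).posSemidef.dotProduct_mulVec_nonneg w

lemma noisyCov_isUnit_det {n : ℕ} (s : Fin n → S) : IsUnit (M.noisyCov s).det :=
  (Matrix.isUnit_iff_isUnit_det _).1 (M.noisyCov_posDef s).isUnit

lemma crossCov_conjTranspose {m n : ℕ} (a : Fin m → S) (s : Fin n → S) :
    (M.crossCov a s)ᴴ = M.crossCov s a := by
  ext i j
  simp [crossCov, M.cov_comm]

/-- This is the Schur complement of the joint noisy covariance of the old and new measurements. -/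
lemma postCov_posSemidef (d : History S) (a : Fin κ → S) : (M.postCov d a).PosSemidef := by
  have hA := M.noisyCov_posDef d.loc
  have : Invertible (M.noisyCov d.loc) := hA.isUnit.invertible
  have h := (PosDef.fromBlocks₁₁ (M.crossCov d.loc a) (M.noisyCov a) hA).1 (by
    have : Matrix.fromBlocks (M.noisyCov d.loc) (M.crossCov d.loc a) (M.crossCov d.loc a)ᴴ
        (M.noisyCov a) = M.cov.submatrix (Sum.elim d.loc a) (Sum.elim d.loc a) +
          M.noiseVar • (1 : Matrix (Fin d.len ⊕ Fin κ) (Fin d.len ⊕ Fin κ) ℝ) := by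
      rw [crossCov_conjTranspose, ← fromBlocks_one, fromBlocks_smul]
      ext i j
      rcases i with i | i <;> rcases j with j | j <;> simp [noisyCov, crossCov]
    rw [this]
    exact (M.cov_submatrix_posSemidef _).add (PosSemidef.one.smul M.noiseVar_pos.le))
  rw [crossCov_conjTranspose] at h
  exact h

lemma postCov_diag_le (d : History S) (a : Fin κ → S) (i : Fin κ) :
    M.postCov d a i i ≤ M.cov (a i) (a i) + M.noiseVar := by
  have h := ((M.noisyCov_posDef d.loc).inv.posSemidef.mul_mul_conjTranspose_same
    (M.crossCov a d.loc)).diag_nonneg (i := i)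
  rw [crossCov_conjTranspose] at h
  simp only [postCov, Matrix.sub_apply]
  have : M.noisyCov a i i = M.cov (a i) (a i) + M.noiseVar := by simp [noisyCov]
  linarith

/-- Cauchy–Schwarz for the prior covariance form: with `x` adjoined to `s` and weights `(t, w)`, the
form is a nonnegative quadratic in `t`, so its discriminant is nonpositive. The noise only enlarges
the constant term. -/
lemma sq_sum_cov_le {n : ℕ} (x : S) (s : Fin n → S) (w : Fin n → ℝ) :
    (∑ j, M.cov x (s j) * w j) ^ 2 ≤ M.cov x x * (w ⬝ᵥ M.noisyCov s *ᵥ w) := by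
  set b := ∑ j, M.cov x (s j) * w j with hb
  have hq : ∀ t : ℝ, 0 ≤ M.cov x x * (t * t) + 2 * b * t + w ⬝ᵥ M.noisyCov s *ᵥ w := by
    intro t
    have h := (M.cov_submatrix_posSemidef (Fin.cons x s : Fin (n + 1) → S)).dotProduct_mulVec_nonneg
      (Fin.cons t w)
    have h2 := M.noiseVar_pos.le
    have h3 : 0 ≤ w ⬝ᵥ w := by simpa using dotProduct_star_self_nonneg w
    have e : star (Fin.cons t w : Fin (n + 1) → ℝ) ⬝ᵥ
        (M.cov.submatrix (Fin.cons x s : Fin (n + 1) → S) (Fin.cons x s : Fin (n + 1) → S)) *ᵥ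
          (Fin.cons t w : Fin (n + 1) → ℝ) =
        M.cov x x * (t * t) + 2 * b * t + w ⬝ᵥ (M.cov.submatrix s s) *ᵥ w := by
      simp only [star_trivial, dotProduct, mulVec, Fin.sum_univ_succ, Fin.cons_zero, Fin.cons_succ,
        submatrix_apply, mul_add, Finset.sum_add_distrib, ← hb]
      have : ∑ i, w i * (M.cov (s i) x * t) = b * t := by
        rw [hb, Finset.sum_mul]
        exact Finset.sum_congr rfl fun i _ => by rw [M.cov_comm (s i) x]; ring
      rw [this]
      ring
    rw [e] at h
    simp only [noisyCov, add_mulVec, dotProduct_add, smul_mulVec, one_mulVec, dotProduct_smul,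
      smul_eq_mul]
    nlinarith
  have := discrim_le_zero hq
  unfold discrim at this
  nlinarith

lemma sum_crossCov_mulVec_le {n : ℕ} {v : ℝ} (hv : ∀ x, M.cov x x ≤ v) (a : Fin κ → S)
    (s : Fin n → S) (w : Fin n → ℝ) :
    ∑ i, (M.crossCov a s *ᵥ w) i ≤ κ * √v * √(w ⬝ᵥ M.noisyCov s *ᵥ w) := by
  have hE := M.dotProduct_noisyCov_nonneg s w
  calc ∑ i, (M.crossCov a s *ᵥ w) i ≤ ∑ _i : Fin κ, √v * √(w ⬝ᵥ M.noisyCov s *ᵥ w) := by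
        refine Finset.sum_le_sum fun i _ => ?_
        rw [← Real.sqrt_mul' _ hE]
        exact Real.le_sqrt_of_sq_le ((M.sq_sum_cov_le (a i) s w).trans
          (mul_le_mul_of_nonneg_right (hv _) hE))
    _ = _ := by simp [mul_assoc]

/-- The lower block is exactly the shift of the posterior mean at `a`. Displacements of the form
covariance times weights are therefore stable under extension of the data, and the new entries of
the weight vector are zero. -/
lemma noisyCov_append_mulVec {n : ℕ} (s : Fin n → S) (a : Fin κ → S) (w : Fin n → ℝ) :
    M.noisyCov (Fin.append s a) *ᵥ Fin.append w 0 =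
      Fin.append (M.noisyCov s *ᵥ w) (M.crossCov a s *ᵥ w) := by
  ext i
  refine Fin.addCases (fun i => ?_) (fun i => ?_) i
  · simp [noisyCov, mulVec, dotProduct, Fin.sum_univ_add, Matrix.one_apply]
  · have h : ∀ j : Fin n, Fin.natAdd n i ≠ Fin.castAdd κ j := fun j h => by
      have := congrArg Fin.val h
      simp at this
      omega
    simp [noisyCov, crossCov, mulVec, dotProduct, Fin.sum_univ_add, Matrix.one_apply, h]

lemma dotProduct_noisyCov_append {n : ℕ} (s : Fin n → S) (a : Fin κ → S) (w : Fin n → ℝ) :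
    Fin.append w 0 ⬝ᵥ M.noisyCov (Fin.append s a) *ᵥ Fin.append w 0 =
      w ⬝ᵥ M.noisyCov s *ᵥ w := by
  rw [noisyCov_append_mulVec]
  simp [dotProduct, Fin.sum_univ_add]

lemma postMean_shift (d : History S) (z w : Fin d.len → ℝ) (a : Fin κ → S) :
    M.postMean (d.withObs (z + M.noisyCov d.loc *ᵥ w)) a =
      M.postMean (d.withObs z) a + WithLp.toLp 2 (M.crossCov a d.loc *ᵥ w) := by
  have hu := M.noisyCov_isUnit_det d.loc
  change WithLp.toLp 2 ((M.crossCov a d.loc * (M.noisyCov d.loc)⁻¹) *ᵥ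
    (z + M.noisyCov d.loc *ᵥ w)) = WithLp.toLp 2 ((M.crossCov a d.loc * (M.noisyCov d.loc)⁻¹) *ᵥ z +
      M.crossCov a d.loc *ᵥ w)
  rw [mulVec_add, mulVec_mulVec w, Matrix.mul_assoc, nonsing_inv_mul _ hu, Matrix.mul_one]

end Model

lemma multivariateGaussian_add_const {ι : Type*} [Fintype ι] [DecidableEq ι]
    (m h : EuclideanSpace ℝ ι) (C : Matrix ι ι ℝ) :
    multivariateGaussian (m + h) C = (multivariateGaussian m C).map (· + h) := by
  unfold multivariateGaussian
  rw [Measure.map_map (by fun_prop) (by fun_prop)]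
  congr 1
  ext x : 1
  simp only [Function.comp]
  abel

namespace Model

variable (M : Model S κ)

instance (d : History S) (a : Fin κ → S) : IsProbabilityMeasure (M.posterior d a) := by
  unfold posterior
  infer_instance

instance (d : History S) (a : Fin κ → S) : IsGaussian (M.posterior d a) := by
  unfold posterior
  infer_instance

/-- The posterior covariance does not see the measurements, so only the mean moves. This translation
is the coupling used to compare the expectations in the Bellman equation. -/
lemma posterior_shift (d : History S) (z w : Fin d.len → ℝ) (a : Fin κ → S) :
    M.posterior (d.withObs (z + M.noisyCov d.loc *ᵥ w)) a =
      (M.posterior (d.withObs z) a).map (· + WithLp.toLp 2 (M.crossCov a d.loc *ᵥ w)) := by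
  unfold posterior
  rw [postMean_shift, multivariateGaussian_add_const]
  rfl

lemma reward_shift (d : History S) (z w : Fin d.len → ℝ) (a : Fin κ → S) :
    M.reward (d.withObs (z + M.noisyCov d.loc *ᵥ w)) a =
      M.reward (d.withObs z) a + ∑ i, (M.crossCov a d.loc *ᵥ w) i := by
  have h : M.postCov (d.withObs (z + M.noisyCov d.loc *ᵥ w)) a = M.postCov (d.withObs z) a := rfl
  unfold reward
  rw [postMean_shift, h]
  simp only [PiLp.add_apply, Finset.sum_add_distrib]
  ring

/-! ### Lipschitz continuity of the optimal values in the measurements -/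

/-- A function of the data is `K`-Lipschitz in the measurements, with respect to the norm that is
dual to the energy norm of the noisy covariance matrix. -/
def EnergyLipschitz (K : ℝ) (f : History S → ℝ) : Prop :=
  ∀ (n : ℕ) (hn : 0 < n) (s : Fin n → S) (z w : Fin n → ℝ),
    f ⟨n, hn, s, z + M.noisyCov s *ᵥ w⟩ ≤ f ⟨n, hn, s, z⟩ + K * √(w ⬝ᵥ M.noisyCov s *ᵥ w)

variable {M}

/-- Any displacement `D` is `Σ w` with `w = Σ⁻¹ D`, and its energy `w ⬝ᵥ D` is at most `D ⬝ᵥ D /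
noiseVar`, because `Σ` dominates `noiseVar` times the identity. -/
lemma EnergyLipschitz.le_add_norm {K : ℝ} (hK : 0 ≤ K) {f : History S → ℝ}
    (hf : M.EnergyLipschitz K f) (d : History S) (z z' : Fin d.len → ℝ) :
    f (d.withObs z') ≤ f (d.withObs z) +
      K / √M.noiseVar * ‖(WithLp.toLp 2 (z' - z) : EuclideanSpace ℝ (Fin d.len))‖ := by
  set D := z' - z with hD
  set w := (M.noisyCov d.loc)⁻¹ *ᵥ D with hw
  have hu := M.noisyCov_isUnit_det d.loc
  have hD' : M.noisyCov d.loc *ᵥ w = D := by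
    rw [hw, mulVec_mulVec, mul_nonsing_inv _ hu, one_mulVec]
  have h : f (d.withObs (z + M.noisyCov d.loc *ᵥ w)) ≤
      f (d.withObs z) + K * √(w ⬝ᵥ M.noisyCov d.loc *ᵥ w) := hf _ d.len_pos d.loc z w
  rw [hD'] at h
  have hz : z + D = z' := by rw [hD]; abel
  rw [hz] at h
  have hs := M.noiseVar_pos
  have h1 := M.noiseVar_mul_dotProduct_le d.loc w
  rw [hD'] at h1
  have hww : 0 ≤ w ⬝ᵥ w := by simpa using dotProduct_star_self_nonneg w
  have hDD : 0 ≤ D ⬝ᵥ D := by simpa using dotProduct_star_self_nonneg D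
  have hn : ‖(WithLp.toLp 2 D : EuclideanSpace ℝ (Fin d.len))‖ = √(D ⬝ᵥ D) := by
    rw [EuclideanSpace.norm_eq]
    simp [dotProduct, pow_two]
  have h2 : w ⬝ᵥ D ≤ D ⬝ᵥ D / M.noiseVar := by
    rw [le_div_iff₀ hs]
    -- Expanding this square and inserting `h1` avoids any spectral argument for `Σ⁻¹`.
    have hsq : 0 ≤ (D - M.noiseVar • w) ⬝ᵥ (D - M.noiseVar • w) := by
      simpa using dotProduct_star_self_nonneg (D - M.noiseVar • w)
    simp only [sub_dotProduct, dotProduct_sub, smul_dotProduct, dotProduct_smul, smul_eq_mul,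
      dotProduct_comm D w] at hsq
    nlinarith
  rw [hn, div_mul_eq_mul_div, mul_div_assoc, ← Real.sqrt_div hDD]
  refine h.trans ?_
  gcongr

lemma EnergyLipschitz.abs_sub_le_norm {K : ℝ} (hK : 0 ≤ K) {f : History S → ℝ}
    (hf : M.EnergyLipschitz K f) (d : History S) (z z' : Fin d.len → ℝ) :
    |f (d.withObs z') - f (d.withObs z)| ≤
      K / √M.noiseVar * ‖(WithLp.toLp 2 (z' - z) : EuclideanSpace ℝ (Fin d.len))‖ := by
  have h1 := hf.le_add_norm hK d z z'
  have h2 := hf.le_add_norm hK d z' z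
  rw [← neg_sub z' z, WithLp.toLp_neg, norm_neg] at h2
  rw [abs_le]
  constructor <;> linarith

lemma EnergyLipschitz.continuous {K : ℝ} (hK : 0 ≤ K) {f : History S → ℝ}
    (hf : M.EnergyLipschitz K f) (d : History S) : Continuous fun z => f (d.withObs z) := by
  have h : LipschitzWith (K / √M.noiseVar).toNNReal
      fun z : EuclideanSpace ℝ (Fin d.len) => f (d.withObs z.ofLp) := by
    refine LipschitzWith.of_dist_le_mul fun x y => ?_
    rw [Real.coe_toNNReal _ (by positivity), Real.dist_eq, dist_eq_norm]
    exact hf.abs_sub_le_norm hK d y.ofLp x.ofLp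
  exact h.continuous.comp (PiLp.continuous_toLp 2 _)

lemma norm_toLp_append_sub {n : ℕ} (z : Fin n → ℝ) (x y : EuclideanSpace ℝ (Fin κ)) :
    ‖(WithLp.toLp 2 (Fin.append z (fun i => x i) - Fin.append z (fun i => y i)) :
      EuclideanSpace ℝ (Fin (n + κ)))‖ = ‖x - y‖ := by
  rw [EuclideanSpace.norm_eq, EuclideanSpace.norm_eq]
  simp [Fin.sum_univ_add]

lemma EnergyLipschitz.lipschitzWith_extend {K : ℝ} (hK : 0 ≤ K) {f : History S → ℝ}
    (hf : M.EnergyLipschitz K f) (d : History S) (a : Fin κ → S) :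
    LipschitzWith (K / √M.noiseVar).toNNReal fun y => f (d.extend a y) := by
  refine LipschitzWith.of_dist_le_mul fun x y => ?_
  rw [Real.coe_toNNReal _ (by positivity), Real.dist_eq, dist_eq_norm,
    ← norm_toLp_append_sub d.obs x y]
  exact hf.abs_sub_le_norm hK (d.extend a 0) _ _

end Model

lemma LipschitzWith.integrable_of_isGaussian {E : Type*} [NormedAddCommGroup E] [NormedSpace ℝ E]
    [MeasurableSpace E] [BorelSpace E] [SecondCountableTopology E] [CompleteSpace E]
    {g : Measure E} [IsGaussian g]
    {K : NNReal} {f : E → ℝ} (hf : LipschitzWith K f) : Integrable f g := by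
  refine Integrable.mono' (g := fun x => ‖f 0‖ + K * ‖x‖)
    ((integrable_const _).add (IsGaussian.integrable_id.norm.const_mul _))
    hf.continuous.aestronglyMeasurable (Filter.Eventually.of_forall fun x => ?_)
  have := hf.dist_le_mul x 0
  rw [dist_eq_norm, dist_zero_right] at this
  have h2 := norm_sub_norm_le (f x) (f 0)
  linarith

namespace Model

variable (M : Model S κ)

/-- The two posteriors are coupled by translation. The reward changes by at most `κ√v` times the
energy norm, and the coupled children differ by a displacement of unchanged energy, to which the
bound for `optV m` applies. -/
lemma energyLipschitz_optQ_of_optV {v : ℝ} (hv : ∀ x, M.cov x x ≤ v) (m : ℕ)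
    (ih : M.EnergyLipschitz (m * κ * √v) (M.optV m)) (d : History S) (z w : Fin d.len → ℝ)
    (a : Fin κ → S) :
    M.optQ m (d.withObs (z + M.noisyCov d.loc *ᵥ w)) a ≤ M.optQ m (d.withObs z) a +
      (m + 1 : ℕ) * κ * √v * √(w ⬝ᵥ M.noisyCov d.loc *ᵥ w) := by
  have hK : 0 ≤ m * κ * √v := by positivity
  set h := M.crossCov a d.loc *ᵥ w with hh
  set r := √(w ⬝ᵥ M.noisyCov d.loc *ᵥ w) with hr
  unfold optQ
  rw [reward_shift, posterior_shift]
  have hl := ih.lipschitzWith_extend hK (d.withObs z) a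
  have hl' := ih.lipschitzWith_extend hK (d.withObs (z + M.noisyCov d.loc *ᵥ w)) a
  rw [integral_map (by fun_prop) hl'.continuous.aestronglyMeasurable]
  have key : ∀ y : EuclideanSpace ℝ (Fin κ),
      M.optV m ((d.withObs (z + M.noisyCov d.loc *ᵥ w)).extend a (y + WithLp.toLp 2 h)) ≤
        M.optV m ((d.withObs z).extend a y) + m * κ * √v * r := by
    intro y
    have := ih _ (Nat.add_pos_left d.len_pos κ) (Fin.append d.loc a) (Fin.append z (fun i => y i))
      (Fin.append w 0)
    rw [M.dotProduct_noisyCov_append, M.noisyCov_append_mulVec] at this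
    have e : Fin.append (z + M.noisyCov d.loc *ᵥ w) (fun i => (y + WithLp.toLp 2 h) i) =
        Fin.append z (fun i => y i) + Fin.append (M.noisyCov d.loc *ᵥ w) h := by
      ext i
      refine Fin.addCases (fun i => ?_) (fun i => ?_) i <;> simp
    rw [← e] at this
    exact this
  have hint : Integrable (fun y => M.optV m ((d.withObs z).extend a y))
      (M.posterior (d.withObs z) a) := LipschitzWith.integrable_of_isGaussian hl
  have hint' : Integrable (fun y => M.optV m
      ((d.withObs (z + M.noisyCov d.loc *ᵥ w)).extend a (y + WithLp.toLp 2 h)))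
      (M.posterior (d.withObs z) a) :=
    LipschitzWith.integrable_of_isGaussian
      (hl'.comp ((isometry_add_right (WithLp.toLp 2 h)).lipschitz))
  have := integral_mono hint' (hint.add (integrable_const (m * κ * √v * r))) key
  simp only [Pi.add_apply] at this
  rw [integral_add hint (integrable_const _), integral_const] at this
  simp only [probReal_univ, one_smul] at this
  have h3 := M.sum_crossCov_mulVec_le hv a d.loc w
  push_cast
  rw [← hh, ← hr] at h3
  linarith

lemma energyLipschitz_optV {v : ℝ} (hv : ∀ x, M.cov x x ≤ v) (m : ℕ) :
    M.EnergyLipschitz (m * κ * √v) (M.optV m) := by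
  induction m with
  | zero => intro n hn s z w; simp [optV]
  | succ m ih =>
    intro n hn s z w
    rw [optV_succ]
    refine Finset.sup'_le _ _ fun a ha => ?_
    refine (M.energyLipschitz_optQ_of_optV hv m ih ⟨n, hn, s, z⟩ z w a).trans ?_
    gcongr
    exact Finset.le_sup' (M.optQ m ⟨n, hn, s, z⟩) ha

end Model

end MacroGPO

/-! ### Concentration of Lipschitz functions of Gaussian vectors -/

namespace MacroGPO

open scoped NNReal

/-- The power series are compared term by term: `(c * ‖x‖) ^ 2` is the mean of the squares `(c * √κ
* x i) ^ 2`, and Jensen applies to each power `n`. It reduces the norm to coordinates, whose laws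
are one-dimensional Gaussians. -/
lemma cosh_mul_norm_le {κ : ℕ} (hκ : 0 < κ) (c : ℝ) (x : EuclideanSpace ℝ (Fin κ)) :
    Real.cosh (c * ‖x‖) ≤ ∑ i, (κ : ℝ)⁻¹ * Real.cosh (c * √κ * x i) := by
  have hκ' : (κ : ℝ) ≠ 0 := by positivity
  refine hasSum_le (fun n => ?_) (Real.hasSum_cosh (c * ‖x‖))
    (hasSum_sum fun i _ => (Real.hasSum_cosh (c * √κ * x i)).mul_left (κ : ℝ)⁻¹)
  have h := Real.pow_arith_mean_le_arith_mean_pow Finset.univ (fun _ : Fin κ => (κ : ℝ)⁻¹)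
    (fun i => (c * √κ * x i) ^ 2) (fun _ _ => by positivity) (by simp [hκ'])
    (fun _ _ => by positivity) n
  have e : ∑ i, (κ : ℝ)⁻¹ * (c * √κ * x i) ^ 2 = (c * ‖x‖) ^ 2 := by
    rw [mul_pow, EuclideanSpace.real_norm_sq_eq, Finset.mul_sum]
    refine Finset.sum_congr rfl fun i _ => ?_
    rw [mul_pow, mul_pow, Real.sq_sqrt (by positivity)]
    field_simp
  rw [e] at h
  simp only [pow_mul, mul_div_assoc', ← Finset.sum_div]
  gcongr

section

variable {E : Type*} [MeasurableSpace E] {g : Measure E}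

lemma integrable_cosh_sub_prod {f : E → ℝ} (hf : ∀ t, Integrable (fun x => Real.exp (t * f x)) g)
    (t : ℝ) : Integrable (fun p : E × E => Real.cosh (t * (f p.1 - f p.2))) (g.prod g) := by
  have h1 := (hf t).mul_prod (hf (-t))
  have h2 := (hf (-t)).mul_prod (hf t)
  refine ((h1.add h2).div_const 2).congr (Filter.Eventually.of_forall fun p => ?_)
  simp only [Pi.add_apply, ← Real.exp_add, Real.cosh_eq]
  ring_nf

lemma integral_cosh_sub_prod [SFinite g] {f : E → ℝ} (hf : ∀ t, Integrable (fun x => Real.exp (t * f x)) g)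
    (t : ℝ) : ∫ p : E × E, Real.cosh (t * (f p.1 - f p.2)) ∂(g.prod g) = mgf f g t * mgf f g (-t) := by
  have h1 := (hf t).mul_prod (hf (-t))
  have h2 := (hf (-t)).mul_prod (hf t)
  have e : (fun p : E × E => Real.cosh (t * (f p.1 - f p.2))) = fun p =>
      (Real.exp (t * f p.1) * Real.exp (-t * f p.2) +
        Real.exp (-t * f p.1) * Real.exp (t * f p.2)) / 2 := by
    ext p
    simp only [← Real.exp_add, Real.cosh_eq]
    ring_nf
  rw [e, integral_div, integral_add h1 h2,
    integral_prod_mul (fun x => Real.exp (t * f x)) (fun x => Real.exp (-t * f x)),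
    integral_prod_mul (fun x => Real.exp (-t * f x)) (fun x => Real.exp (t * f x))]
  simp only [mgf]
  ring

lemma exp_neg_mul_integral_le_mgf [IsProbabilityMeasure g] {f : E → ℝ} (hi : Integrable f g)
    (hf : ∀ t, Integrable (fun x => Real.exp (t * f x)) g) (t : ℝ) :
    Real.exp (-(t * ∫ x, f x ∂g)) ≤ mgf f g (-t) := by
  have h := convexOn_exp.map_integral_le (f := fun x => -t * f x) (μ := g)
    Real.continuous_exp.continuousOn isClosed_univ (by simp) (hi.const_mul _) (hf (-t))
  rw [integral_const_mul, neg_mul] at h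
  exact h

end

/-- Symmetrization: the left side is the expectation of `cosh (t * (f X - f X'))` for independent
copies. As `cosh` increases with the modulus, `f X - f X'` may be replaced by `K * ‖X - X'‖`, and
the norm then splits into coordinates. -/
lemma LipschitzWith.mgf_mul_mgf_neg_le {κ : ℕ} (hκ : 0 < κ) {g : Measure (EuclideanSpace ℝ (Fin κ))}
    [SFinite g] {f : EuclideanSpace ℝ (Fin κ) → ℝ} {K : ℝ≥0} (hf : LipschitzWith K f)
    (hexp : ∀ t, Integrable (fun x => Real.exp (t * f x)) g)
    (hcoord : ∀ i t, Integrable (fun x => Real.exp (t * x i)) g) (t : ℝ) :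
    mgf f g t * mgf f g (-t) ≤ ∑ i, (κ : ℝ)⁻¹ *
      (mgf (fun x => x i) g (t * K * √κ) * mgf (fun x => x i) g (-(t * K * √κ))) := by
  have hprod : ∀ i s, Integrable (fun p : EuclideanSpace ℝ (Fin κ) × EuclideanSpace ℝ (Fin κ) =>
      Real.cosh (s * (p.1 i - p.2 i))) (g.prod g) := fun i =>
    integrable_cosh_sub_prod (f := fun x : EuclideanSpace ℝ (Fin κ) => x i) (hcoord i)
  have hint : ∀ i, Integrable (fun p : EuclideanSpace ℝ (Fin κ) × EuclideanSpace ℝ (Fin κ) =>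
      (κ : ℝ)⁻¹ * Real.cosh (t * K * √κ * (p.1 i - p.2 i))) (g.prod g) := fun i =>
    (hprod i _).const_mul _
  have hpt : ∀ p : EuclideanSpace ℝ (Fin κ) × EuclideanSpace ℝ (Fin κ),
      Real.cosh (t * (f p.1 - f p.2)) ≤
        ∑ i, (κ : ℝ)⁻¹ * Real.cosh (t * K * √κ * (p.1 i - p.2 i)) := by
    intro p
    have h := cosh_mul_norm_le hκ (t * K) (p.1 - p.2)
    simp only [PiLp.sub_apply] at h
    refine le_trans ?_ h
    rw [Real.cosh_le_cosh, abs_mul, abs_mul, abs_mul, abs_of_nonneg (norm_nonneg (p.1 - p.2)),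
      abs_of_nonneg K.coe_nonneg, mul_assoc, ← dist_eq_norm, ← Real.dist_eq]
    gcongr
    exact hf.dist_le_mul _ _
  rw [← integral_cosh_sub_prod hexp t]
  have hsum : Integrable (fun p : EuclideanSpace ℝ (Fin κ) × EuclideanSpace ℝ (Fin κ) =>
      ∑ i, (κ : ℝ)⁻¹ * Real.cosh (t * K * √κ * (p.1 i - p.2 i))) (g.prod g) :=
    integrable_finsetSum _ fun i _ => hint i
  have hle := integral_mono (integrable_cosh_sub_prod hexp t) hsum hpt
  refine hle.trans (le_of_eq ?_)
  rw [integral_finsetSum _ fun i _ => hint i]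
  refine Finset.sum_congr rfl fun i _ => ?_
  rw [integral_const_mul, integral_cosh_sub_prod (f := fun x : EuclideanSpace ℝ (Fin κ) => x i) (hcoord i)]

section Gaussian

variable {κ : ℕ} {m : EuclideanSpace ℝ (Fin κ)} {C : Matrix (Fin κ) (Fin κ) ℝ}

lemma integrable_exp_mul_coord (hC : C.PosSemidef) (i : Fin κ) (t : ℝ) :
    Integrable (fun x => Real.exp (t * x i)) (multivariateGaussian m C) :=
  ((measurePreserving_eval_multivariateGaussian (μ := m) hC (i := i)).integrable_comp
    (by fun_prop)).2 (integrable_exp_mul_gaussianReal t)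

lemma mgf_coord (hC : C.PosSemidef) (i : Fin κ) (t : ℝ) :
    mgf (fun x => x i) (multivariateGaussian m C) t = Real.exp (m i * t + C i i * t ^ 2 / 2) := by
  rw [mgf_gaussianReal (measurePreserving_eval_multivariateGaussian (μ := m) hC (i := i)).map_eq,
    Real.coe_toNNReal _ hC.diag_nonneg]

lemma integrable_cosh_mul_norm (hκ : 0 < κ) (hC : C.PosSemidef) (t : ℝ) :
    Integrable (fun x => Real.cosh (t * ‖x‖)) (multivariateGaussian m C) := by
  refine Integrable.mono' (g := fun x => ∑ i, (κ : ℝ)⁻¹ * Real.cosh (t * √κ * x i)) ?_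
    (Continuous.aestronglyMeasurable (by fun_prop)) (Filter.Eventually.of_forall fun x => ?_)
  · refine integrable_finsetSum _ fun i _ => Integrable.const_mul ?_ _
    refine (((integrable_exp_mul_coord hC i (t * √κ)).add
      (integrable_exp_mul_coord hC i (-(t * √κ)))).div_const 2).congr
      (Filter.Eventually.of_forall fun x => ?_)
    simp only [Pi.add_apply, Real.cosh_eq]
    ring_nf
  · rw [Real.norm_eq_abs, abs_of_pos (Real.cosh_pos _)]
    exact cosh_mul_norm_le hκ t x

variable {f : EuclideanSpace ℝ (Fin κ) → ℝ} {K : ℝ≥0}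

lemma LipschitzWith.integrable_exp_mul (hf : LipschitzWith K f) (hκ : 0 < κ) (hC : C.PosSemidef)
    (t : ℝ) : Integrable (fun x => Real.exp (t * f x)) (multivariateGaussian m C) := by
  refine Integrable.mono' (g := fun x => Real.exp (t * f 0) * (2 * Real.cosh (|t| * K * ‖x‖)))
    (((integrable_cosh_mul_norm hκ hC _).const_mul _).const_mul _)
    (Real.continuous_exp.comp (hf.continuous.const_mul t)).aestronglyMeasurable
    (Filter.Eventually.of_forall fun x => ?_)
  have h := hf.dist_le_mul x 0
  rw [dist_zero_right, Real.dist_eq] at h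
  have h1 : t * f x ≤ t * f 0 + |t| * K * ‖x‖ := by
    have h2 : t * (f x - f 0) ≤ |t| * |f x - f 0| := by
      rw [← abs_mul]; exact le_abs_self _
    have h3 := mul_le_mul_of_nonneg_left h (abs_nonneg t)
    linarith
  have h4 := Real.exp_pos (-(|t| * K * ‖x‖))
  rw [Real.norm_eq_abs, abs_of_pos (Real.exp_pos _), Real.cosh_eq]
  calc Real.exp (t * f x) ≤ Real.exp (t * f 0) * Real.exp (|t| * K * ‖x‖) := by
        rw [← Real.exp_add]; exact Real.exp_le_exp.2 h1
    _ ≤ _ := by gcongr; linarith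

/-- A Lipschitz function of a Gaussian vector is sub-Gaussian, with a variance proxy that grows
linearly with the dimension. -/
lemma LipschitzWith.hasSubgaussianMGF (hf : LipschitzWith K f) (hκ : 0 < κ) (hC : C.PosSemidef)
    {u : ℝ≥0} (hu : ∀ i, C i i ≤ u) :
    HasSubgaussianMGF (fun x => f x - ∫ y, f y ∂(multivariateGaussian m C)) (2 * K ^ 2 * κ * u)
      (multivariateGaussian m C) := by
  set g := multivariateGaussian m C with hg
  set e := ∫ y, f y ∂g with he
  have hexp : ∀ t, Integrable (fun x => Real.exp (t * f x)) g :=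
    fun t => LipschitzWith.integrable_exp_mul hf hκ hC t
  have hsplit : ∀ t x, Real.exp (t * (f x - e)) = Real.exp (t * f x) * Real.exp (-(t * e)) := by
    intro t x
    rw [← Real.exp_add]
    ring_nf
  refine ⟨fun t => ?_, fun t => ?_⟩
  · simp only [hsplit]
    exact (hexp t).mul_const _
  have hcoord : ∀ i s, Integrable (fun x => Real.exp (s * x i)) g :=
    fun i s => integrable_exp_mul_coord hC i s
  calc mgf (fun x => f x - e) g t = mgf f g t * Real.exp (-(t * e)) := by
        simp only [mgf, hsplit]
        exact integral_mul_const _ _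
    -- Jensen trades the centering for an independent copy; this is what doubles the variance proxy.
    _ ≤ mgf f g t * mgf f g (-t) :=
        mul_le_mul_of_nonneg_left
          (exp_neg_mul_integral_le_mgf (LipschitzWith.integrable_of_isGaussian hf) hexp t) mgf_nonneg
    _ ≤ ∑ i, (κ : ℝ)⁻¹ * (mgf (fun x => x i) g (t * K * √κ) *
          mgf (fun x => x i) g (-(t * K * √κ))) :=
        LipschitzWith.mgf_mul_mgf_neg_le hκ hf hexp hcoord t
    -- The coordinate means cancel between the two factors, so the bound does not depend on `m`.
    _ = ∑ i, (κ : ℝ)⁻¹ * Real.exp (C i i * (t * K * √κ) ^ 2) := by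
        refine Finset.sum_congr rfl fun i _ => ?_
        rw [hg, mgf_coord hC, mgf_coord hC, ← Real.exp_add]
        ring_nf
    _ ≤ ∑ _i : Fin κ, (κ : ℝ)⁻¹ * Real.exp (u * (t * K * √κ) ^ 2) := by
        gcongr with i
        exact hu i
    _ = Real.exp ((2 * K ^ 2 * κ * u : ℝ≥0) * t ^ 2 / 2) := by
        have : (κ : ℝ) ≠ 0 := by positivity
        rw [Finset.sum_const, Finset.card_univ, Fintype.card_fin, nsmul_eq_mul,
          mul_inv_cancel_left₀ this, mul_pow, mul_pow, Real.sq_sqrt (by positivity)]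
        push_cast
        ring_nf

end Gaussian

/-- Two-sided Hoeffding inequality for the empirical mean of i.i.d. draws. -/
lemma pi_empirical_mean_le {E : Type*} [MeasurableSpace E] {g : Measure E} [IsProbabilityMeasure g]
    {N : ℕ} (hN : 0 < N) {f : E → ℝ} {c : ℝ≥0} {e ε : ℝ} (hε : 0 ≤ ε)
    (hf : HasSubgaussianMGF (fun x => f x - e) c g) :
    Measure.pi (fun _ : Fin N => g) {W | ε < |1 / (N : ℝ) * ∑ l, f (W l) - e|} ≤
      ENNReal.ofReal (2 * Real.exp (-(N * ε ^ 2 / (2 * c)))) := by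
  have hN' : (0 : ℝ) < N := by exact_mod_cast hN
  set P := Measure.pi (fun _ : Fin N => g)
  have hsub : ∀ X : E → ℝ, HasSubgaussianMGF X c g →
      P.real {W | N * ε ≤ ∑ l : Fin N, X (W l)} ≤ Real.exp (-(N * ε ^ 2 / (2 * c))) := by
    intro X hX
    have h := HasSubgaussianMGF.measure_sum_ge_le_of_iIndepFun (μ := P)
      (X := fun (l : Fin N) (W : Fin N → E) => X (W l)) (c := fun _ => c) (s := Finset.univ)
      (iIndepFun_pi fun _ => hX.aemeasurable)
      (fun l _ => HasSubgaussianMGF.of_map (Y := Function.eval l)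
        (measurable_pi_apply l).aemeasurable (by
        rw [(measurePreserving_eval (fun _ : Fin N => g) l).map_eq]; exact hX))
      (ε := N * ε) (by positivity)
    refine h.trans (Real.exp_le_exp.2 (le_of_eq ?_))
    rw [Finset.sum_const, Finset.card_univ, Fintype.card_fin]
    push_cast [nsmul_eq_mul]
    -- For `c = 0` both quotients are zero by the convention for division by zero, and the resulting
    -- bound is trivial.
    rcases eq_or_ne (c : ℝ) 0 with h0 | h0
    · simp [h0]
    · field_simp
  have h1 := hsub _ hf
  have h2 := hsub _ hf.neg
  have hsubset : {W : Fin N → E | ε < |1 / (N : ℝ) * ∑ l, f (W l) - e|} ⊆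
      {W | N * ε ≤ ∑ l : Fin N, (f (W l) - e)} ∪
        {W | N * ε ≤ ∑ l : Fin N, (-fun x => f x - e) (W l)} := by
    intro W hW
    simp only [Set.mem_ofPred_eq, Set.mem_union, Pi.neg_apply, Finset.sum_neg_distrib,
      Finset.sum_sub_distrib, Finset.sum_const, Finset.card_univ, Fintype.card_fin,
      nsmul_eq_mul] at hW ⊢
    have e1 : 1 / (N : ℝ) * ∑ l, f (W l) - e = (∑ l, f (W l) - N * e) / N := by field_simp
    rw [e1, abs_div, abs_of_pos hN', lt_div_iff₀ hN', lt_abs] at hW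
    rcases hW with hW | hW
    · left; linarith
    · right; linarith
  calc P _ ≤ _ := measure_mono hsubset
    _ ≤ _ := measure_union_le _ _
    _ ≤ ENNReal.ofReal (Real.exp (-(N * ε ^ 2 / (2 * c)))) +
          ENNReal.ofReal (Real.exp (-(N * ε ^ 2 / (2 * c)))) := by
        refine add_le_add ?_ ?_
        · rw [← ofReal_measureReal]; exact ENNReal.ofReal_le_ofReal h1
        · rw [← ofReal_measureReal]; exact ENNReal.ofReal_le_ofReal h2
    _ = _ := by rw [← ENNReal.ofReal_add (by positivity) (by positivity)]; ring_nf

end MacroGPO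

/-! ### The search tree: measurability, propagation of errors, union bound -/

namespace MacroGPO

open scoped NNReal MatrixOrder

variable {S Ω : Type*} {κ N : ℕ}

lemma nodeData_append_singleton (d : History S) (Z : SampleTree S κ N)
    (p : List ((Fin κ → S) × Fin N)) (a : Fin κ → S) (l : Fin N) :
    nodeData d Z (p ++ [(a, l)]) = (nodeData d Z p).extend a (Z p a l) := by
  induction p generalizing d Z with
  | nil => rfl
  | cons x p ih => exact ih _ _

lemma comap_le_pathSigma (Z : Ω → SampleTree S κ N) (p : List ((Fin κ → S) × Fin N))
    (a : Fin κ → S) (l : Fin N) :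
    MeasurableSpace.comap (fun ω => Z ω p a l) inferInstance ≤ pathSigma Z (p ++ [(a, l)]) :=
  le_iSup_of_le p (le_iSup_of_le a (le_iSup_of_le l (le_iSup_of_le List.prefix_rfl le_rfl)))

lemma pathSigma_le_append (Z : Ω → SampleTree S κ N) (p r : List ((Fin κ → S) × Fin N)) :
    pathSigma Z p ≤ pathSigma Z (p ++ r) :=
  iSup_le fun q => iSup_le fun b => iSup_le fun j => iSup_le fun h =>
    le_iSup_of_le q (le_iSup_of_le b (le_iSup_of_le j
      (le_iSup_of_le (h.trans (List.prefix_append p r)) le_rfl)))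

lemma pathSigma_le [MeasurableSpace Ω] {Z : Ω → SampleTree S κ N}
    (hZ : ∀ p a l, Measurable fun ω => Z ω p a l) (p : List ((Fin κ → S) × Fin N)) :
    pathSigma Z p ≤ (inferInstance : MeasurableSpace Ω) :=
  iSup_le fun q => iSup_le fun b => iSup_le fun j => iSup_le fun _ => (hZ q b j).comap_le

/-- The locations at a node are deterministic, and the measurements are a measurable function of
the samples on the path to the node. -/
lemma exists_nodeData_eq (d : History S) (Z : Ω → SampleTree S κ N)
    (p : List ((Fin κ → S) × Fin N)) :
    ∃ (n : ℕ) (hn : 0 < n) (s : Fin n → S) (o : Ω → Fin n → ℝ),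
      (∀ i, Measurable[pathSigma Z p] fun ω => o ω i) ∧
        ∀ ω, nodeData d (Z ω) p = ⟨n, hn, s, o ω⟩ := by
  induction p using List.reverseRecOn with
  | nil => exact ⟨d.len, d.len_pos, d.loc, fun _ => d.obs, fun i => measurable_const, fun _ => rfl⟩
  | append_singleton p x ih =>
    obtain ⟨n, hn, s, o, ho, h⟩ := ih
    obtain ⟨a, l⟩ := x
    refine ⟨n + κ, Nat.add_pos_left hn κ, Fin.append s a,
      fun ω => Fin.append (o ω) (fun i => Z ω p a l i), fun i => ?_, fun ω => ?_⟩
    · refine Fin.addCases (fun i => ?_) (fun i => ?_) i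
      · simp only [Fin.append_left]
        exact (ho i).mono (pathSigma_le_append Z p _) le_rfl
      · simp only [Fin.append_right]
        have h1 : Measurable[pathSigma Z (p ++ [(a, l)])] fun ω => Z ω p a l :=
          (comap_measurable _).mono (comap_le_pathSigma Z p a l) le_rfl
        exact (show Measurable fun y : EuclideanSpace ℝ (Fin κ) => y i by fun_prop).comp h1
    · rw [nodeData_append_singleton, h]
      rfl

namespace Model

variable (M : Model S κ)

lemma Feasible.congr_obs {M : Model S κ} {as : List (Fin κ → S)} {n : ℕ} {hn : 0 < n}
    {s : Fin n → S} {z z' : Fin n → ℝ} (h : M.Feasible ⟨n, hn, s, z⟩ as) :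
    M.Feasible ⟨n, hn, s, z'⟩ as := by
  induction as generalizing n with
  | nil => trivial
  | cons a as ih => exact ⟨h.1, ih h.2⟩

lemma Feasible.append_singleton {M : Model S κ} {d : History S} {Z : SampleTree S κ N}
    {p : List ((Fin κ → S) × Fin N)} {a : Fin κ → S} (hp : M.Feasible d (p.map Prod.fst))
    (ha : a ∈ M.actions (nodeData d Z p).current) :
    M.Feasible d (p.map Prod.fst ++ [a]) := by
  induction p generalizing d Z with
  | nil => exact ⟨ha, trivial⟩
  | cons x p ih =>
    refine ⟨hp.1, ?_⟩
    have h := ih (d := d.extend x.1 (Z [] x.1 x.2)) (Z := fun q => Z (x :: q)) hp.2.congr_obs ha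
    exact h.congr_obs

/-- At every node of the first `m` levels of the search tree, the empirical means of the optimal
values of the children are `ε`-close to the expectations that they approximate. -/
def Accurate (ε : ℝ) : ℕ → History S → SampleTree S κ N → Prop
  | 0, _, _ => True
  | m + 1, d, Z => ∀ a ∈ M.actions d.current,
      |1 / (N : ℝ) * ∑ l, M.optV (m + 1) (d.extend a (Z [] a l)) -
        ∫ y, M.optV (m + 1) (d.extend a y) ∂(M.posterior d a)| ≤ ε ∧
      ∀ l, Accurate ε m (d.extend a (Z [] a l)) (fun q => Z ((a, l) :: q))

lemma abs_sup'_sub_sup'_le {ι : Type*} {s : Finset ι} (hs : s.Nonempty) {f g : ι → ℝ} {c : ℝ}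
    (h : ∀ i ∈ s, |f i - g i| ≤ c) : |s.sup' hs f - s.sup' hs g| ≤ c := by
  rw [abs_sub_le_iff, sub_le_iff_le_add, sub_le_iff_le_add]
  constructor <;> refine Finset.sup'_le _ _ fun i hi => ?_
  · have := Finset.le_sup' g hi
    linarith [(abs_sub_le_iff.1 (h i hi)).1]
  · have := Finset.le_sup' f hi
    linarith [(abs_sub_le_iff.1 (h i hi)).2]

/-- Maxima and averages are nonexpansive for the sup norm, so the error of the children passes to
the parent unamplified, and each level adds only its own `ε`. -/
lemma Accurate.abs_sampQ_sub_optQ_le {M : Model S κ} {ε : ℝ} (hε : 0 ≤ ε) {m : ℕ} {d : History S}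
    {Z : SampleTree S κ N} (h : M.Accurate ε m d Z) {a : Fin κ → S}
    (ha : a ∈ M.actions d.current) : |M.sampQ m d Z a - M.optQ m d a| ≤ m * ε := by
  induction m generalizing d Z a with
  | zero => simp [sampQ, optQ, sampV, optV]
  | succ m ih =>
    obtain ⟨h1, h2⟩ := h a ha
    have h3 : ∀ l, |M.sampV (m + 1) (d.extend a (Z [] a l)) (fun q => Z ((a, l) :: q)) -
        M.optV (m + 1) (d.extend a (Z [] a l))| ≤ m * ε := fun l => by
      rw [sampV_succ, optV_succ]
      exact abs_sup'_sub_sup'_le _ fun b hb => ih (h2 l) hb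
    have h4 : |1 / (N : ℝ) * ∑ l, (M.sampV (m + 1) (d.extend a (Z [] a l))
        (fun q => Z ((a, l) :: q)) - M.optV (m + 1) (d.extend a (Z [] a l)))| ≤ m * ε := by
      rw [abs_mul, abs_of_nonneg (by positivity)]
      rcases Nat.eq_zero_or_pos N with rfl | hN
      · simp only [Nat.cast_zero, div_zero, zero_mul]
        positivity
      · rw [one_div_mul_eq_div, div_le_iff₀ (by positivity)]
        refine (Finset.abs_sum_le_sum_abs _ _).trans ((Finset.sum_le_sum fun l _ => h3 l).trans ?_)
        simp [mul_comm]
    rw [Finset.sum_sub_distrib, mul_sub] at h4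
    unfold sampQ optQ
    push_cast
    rw [abs_le] at h1 h4 ⊢
    constructor <;> linarith [h1.1, h1.2, h4.1, h4.2]

end Model

/-- If the conditional law of `W` given `Y = x` is the law of `T x`, then a bound on the conditional
probabilities bounds the probability. -/
lemma measure_mem_le_of_conditional {X V Ξ : Type*} [MeasurableSpace Ω] [MeasurableSpace X]
    [MeasurableSpace V] [MeasurableSpace Ξ] {P : Measure Ω} [IsProbabilityMeasure P]
    {R : Measure Ξ} [IsProbabilityMeasure R] {Y : Ω → X} (hY : Measurable Y) {W : Ω → V}
    (hW : Measurable W) {T : X → Ξ → V} (hT : Measurable (Function.uncurry T))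
    (h : ∀ E B, MeasurableSet E → MeasurableSet B →
      P (Y ⁻¹' E ∩ W ⁻¹' B) = ∫⁻ ω in Y ⁻¹' E, R (T (Y ω) ⁻¹' B) ∂P)
    {G : Set (X × V)} (hG : MeasurableSet G) {b : ENNReal}
    (hb : ∀ x, R {ξ | (x, T x ξ) ∈ G} ≤ b) : P {ω | (Y ω, W ω) ∈ G} ≤ b := by
  have hY' := Measure.isProbabilityMeasure_map (μ := P) hY.aemeasurable
  have hF : Measurable fun q : X × Ξ => (q.1, T q.1 q.2) := measurable_fst.prodMk hT
  have hYW : Measurable fun ω => (Y ω, W ω) := hY.prodMk hW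
  have hYW' := Measure.isProbabilityMeasure_map (μ := P) hYW.aemeasurable
  -- The hypothesis `h` is this identity on rectangles, which determine the joint law. In the
  -- product form, Fubini allows `x` to be frozen.
  have key : P.map (fun ω => (Y ω, W ω)) =
      ((P.map Y).prod R).map (fun q : X × Ξ => (q.1, T q.1 q.2)) := by
    refine Measure.ext_prod fun {E B} hE hB => ?_
    rw [Measure.map_apply hYW (hE.prod hB), Measure.map_apply hF (hE.prod hB),
      Measure.prod_apply (hF (hE.prod hB)), lintegral_map (measurable_measure_prodMk_left
        (hF (hE.prod hB))) hY]
    have e : (fun ω => (Y ω, W ω)) ⁻¹' E ×ˢ B = Y ⁻¹' E ∩ W ⁻¹' B := rfl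
    rw [e, h E B hE hB, ← lintegral_indicator (hY hE)]
    refine lintegral_congr fun ω => ?_
    by_cases hω : Y ω ∈ E
    · rw [Set.indicator_of_mem (show ω ∈ Y ⁻¹' E from hω)]
      congr 1
      ext ξ
      simp [hω]
    · rw [Set.indicator_of_notMem (show ω ∉ Y ⁻¹' E from hω)]
      symm
      convert measure_empty (μ := R)
      ext ξ
      simp [hω]
  calc P {ω | (Y ω, W ω) ∈ G} = P.map (fun ω => (Y ω, W ω)) G := (Measure.map_apply hYW hG).symm
    _ = ∫⁻ x, R {ξ | (x, T x ξ) ∈ G} ∂(P.map Y) := by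
        rw [key, Measure.map_apply hF hG, Measure.prod_apply (hF hG)]
        rfl
    _ ≤ ∫⁻ _, b ∂(P.map Y) := lintegral_mono hb
    _ = b := by simp

namespace Model

variable (M : Model S κ)

lemma measurable_postMean {n : ℕ} (hn : 0 < n) (s : Fin n → S) (a : Fin κ → S) :
    Measurable fun z => M.postMean ⟨n, hn, s, z⟩ a := by
  have h : Measurable fun z => (M.crossCov a s * (M.noisyCov s)⁻¹).mulVec z :=
    (Continuous.matrix_mulVec continuous_const continuous_id).measurable
  exact (WithLp.measurable_toLp 2 _).comp h

/-- A single `B`, the square root of the posterior covariance, serves all `z`. The samples thus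
become a jointly measurable function of the measurements and of noise with a fixed law, so no
measurability of the posterior as a kernel has to be proved. -/
lemma exists_pi_posterior_eq_map {n : ℕ} (hn : 0 < n) (s : Fin n → S) (a : Fin κ → S) :
    ∃ B : EuclideanSpace ℝ (Fin κ) →L[ℝ] EuclideanSpace ℝ (Fin κ), ∀ z : Fin n → ℝ,
      Measure.pi (fun _ : Fin N => M.posterior ⟨n, hn, s, z⟩ a) =
      (Measure.pi fun _ : Fin N => stdGaussian (EuclideanSpace ℝ (Fin κ))).map
        fun ξ l => M.postMean ⟨n, hn, s, z⟩ a + B (ξ l) := by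
  refine ⟨Matrix.toEuclideanCLM (𝕜 := ℝ) (CFC.sqrt (M.postCov ⟨n, hn, s, 0⟩ a)), fun z => ?_⟩
  have hm : Measurable fun x : EuclideanSpace ℝ (Fin κ) => M.postMean ⟨n, hn, s, z⟩ a +
      Matrix.toEuclideanCLM (𝕜 := ℝ) (CFC.sqrt (M.postCov ⟨n, hn, s, 0⟩ a)) x := by fun_prop
  have (_ : Fin N) := Measure.isProbabilityMeasure_map
    (μ := stdGaussian (EuclideanSpace ℝ (Fin κ))) hm.aemeasurable
  rw [Measure.pi_map_pi fun _ => hm.aemeasurable]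
  rfl

lemma EnergyLipschitz.continuous_extend {M : Model S κ} {f : History S → ℝ} {L : ℝ} (hL : 0 ≤ L)
    (hfL : M.EnergyLipschitz L f) {n : ℕ} (hn : 0 < n) (s : Fin n → S) (a : Fin κ → S) :
    Continuous fun q : (Fin n → ℝ) × EuclideanSpace ℝ (Fin κ) =>
      f ((⟨n, hn, s, q.1⟩ : History S).extend a q.2) := by
  have h1 := hfL.continuous hL ((⟨n, hn, s, 0⟩ : History S).extend a 0)
  have h2 : Continuous fun q : (Fin n → ℝ) × EuclideanSpace ℝ (Fin κ) =>
      (Fin.append q.1 (fun i => q.2 i) : Fin (n + κ) → ℝ) := by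
    refine continuous_pi fun i => ?_
    refine Fin.addCases (fun i => ?_) (fun i => ?_) i
    · simp only [Fin.append_left]; fun_prop
    · simp only [Fin.append_right]; fun_prop
  exact h1.comp h2

lemma measurable_integral_extend {f : History S → ℝ} {n : ℕ} (hn : 0 < n) (s : Fin n → S)
    (a : Fin κ → S) (hf : Continuous fun q : (Fin n → ℝ) × EuclideanSpace ℝ (Fin κ) =>
      f ((⟨n, hn, s, q.1⟩ : History S).extend a q.2)) :
    Measurable fun z => ∫ y, f ((⟨n, hn, s, z⟩ : History S).extend a y)
      ∂(M.posterior ⟨n, hn, s, z⟩ a) := by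
  set g : (Fin n → ℝ) × EuclideanSpace ℝ (Fin κ) → ℝ :=
    fun q => f ((⟨n, hn, s, q.1⟩ : History S).extend a q.2) with hg
  set B := Matrix.toEuclideanCLM (𝕜 := ℝ) (CFC.sqrt (M.postCov ⟨n, hn, s, 0⟩ a)) with hB
  have e : ∀ z, ∫ y, g (z, y) ∂(M.posterior ⟨n, hn, s, z⟩ a) =
      ∫ ξ, g (z, M.postMean ⟨n, hn, s, z⟩ a + B ξ)
        ∂(stdGaussian (EuclideanSpace ℝ (Fin κ))) := fun z =>
    integral_map (φ := fun ξ => M.postMean ⟨n, hn, s, z⟩ a + B ξ) (by fun_prop)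
      (hf.comp (Continuous.prodMk_right z)).aestronglyMeasurable
  change Measurable fun z => ∫ y, g (z, y) ∂(M.posterior ⟨n, hn, s, z⟩ a)
  simp only [e]
  have h : Measurable fun q : (Fin n → ℝ) × EuclideanSpace ℝ (Fin κ) =>
      g (q.1, M.postMean ⟨n, hn, s, q.1⟩ a + B q.2) :=
    hf.measurable.comp (measurable_fst.prodMk
      (((M.measurable_postMean hn s a).comp measurable_fst).add
        (B.measurable.comp measurable_snd)))
  exact (StronglyMeasurable.integral_prod_right h.stronglyMeasurable).measurable

lemma pi_posterior_deviation_le (hκ : 0 < κ) (hN : 0 < N) (d : History S) (a : Fin κ → S)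
    {f : History S → ℝ} {L : ℝ} (hL : 0 ≤ L) (hfL : M.EnergyLipschitz L f) {u : ℝ≥0}
    (hu : ∀ x, M.cov x x + M.noiseVar ≤ u) {ε : ℝ} (hε : 0 ≤ ε) :
    Measure.pi (fun _ : Fin N => M.posterior d a) {W | ε < |1 / (N : ℝ) * ∑ l, f (d.extend a (W l)) -
      ∫ y, f (d.extend a y) ∂(M.posterior d a)|} ≤
    ENNReal.ofReal (2 * Real.exp (-(N * ε ^ 2 /
      (2 * (2 * (L / √M.noiseVar).toNNReal ^ 2 * κ * u : ℝ≥0))))) := by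
  have hsub : HasSubgaussianMGF (fun y => f (d.extend a y) -
      ∫ y, f (d.extend a y) ∂(M.posterior d a))
      (2 * (L / √M.noiseVar).toNNReal ^ 2 * κ * u) (M.posterior d a) :=
    LipschitzWith.hasSubgaussianMGF (hfL.lipschitzWith_extend hL d a) hκ (M.postCov_posSemidef _ _)
      fun i => (M.postCov_diag_le _ a i).trans (hu _)
  exact pi_empirical_mean_le (f := fun y => f (d.extend a y)) hN hε hsub

lemma measurable_deviation {f : History S → ℝ} {n : ℕ} (hn : 0 < n) (s : Fin n → S)
    (a : Fin κ → S) (hf : Continuous fun q : (Fin n → ℝ) × EuclideanSpace ℝ (Fin κ) =>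
      f ((⟨n, hn, s, q.1⟩ : History S).extend a q.2)) :
    Measurable fun q : (Fin n → ℝ) × (Fin N → EuclideanSpace ℝ (Fin κ)) =>
      |1 / (N : ℝ) * ∑ l, f ((⟨n, hn, s, q.1⟩ : History S).extend a (q.2 l)) -
        ∫ y, f ((⟨n, hn, s, q.1⟩ : History S).extend a y) ∂(M.posterior ⟨n, hn, s, q.1⟩ a)| := by
  have hfst : Measurable (Prod.fst : (Fin n → ℝ) × (Fin N → EuclideanSpace ℝ (Fin κ)) → _) :=
    measurable_fst
  have h1 := (M.measurable_integral_extend hn s a hf).comp hfst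
  have h2 : ∀ l : Fin N, Measurable fun q : (Fin n → ℝ) × (Fin N → EuclideanSpace ℝ (Fin κ)) =>
      f ((⟨n, hn, s, q.1⟩ : History S).extend a (q.2 l)) := fun l =>
    hf.measurable.comp (measurable_fst.prodMk ((measurable_pi_apply l).comp measurable_snd))
  exact (((Finset.measurable_sum _ fun l _ => h2 l).const_mul _).sub h1).abs

/-- Transfer of a bound under the conditional law of the samples at a node. -/
lemma IsSampling.measure_mem_le [MeasurableSpace Ω] {M : Model S κ} {P : Measure Ω}
    [IsProbabilityMeasure P] {m₀ : ℕ} {d : History S} {Z : Ω → SampleTree S κ N}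
    (hZ : M.IsSampling P m₀ d Z) {p : List ((Fin κ → S) × Fin N)} {a : Fin κ → S}
    (hp : p.length < m₀) (hf : M.Feasible d (p.map Prod.fst ++ [a])) {n : ℕ} (hn : 0 < n)
    (s : Fin n → S) {o : Ω → Fin n → ℝ} (ho : ∀ i, Measurable[pathSigma Z p] fun ω => o ω i)
    (hnode : ∀ ω, nodeData d (Z ω) p = ⟨n, hn, s, o ω⟩)
    {G : Set ((Fin n → ℝ) × (Fin N → EuclideanSpace ℝ (Fin κ)))} (hG : MeasurableSet G)
    {b : ENNReal}
    (hb : ∀ z, Measure.pi (fun _ : Fin N => M.posterior ⟨n, hn, s, z⟩ a) (Prod.mk z ⁻¹' G) ≤ b) :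
    P {ω | (o ω, Z ω p a) ∈ G} ≤ b := by
  have ho' : Measurable[pathSigma Z p] o := @measurable_pi_lambda _ _ _ (pathSigma Z p) _ _ ho
  obtain ⟨B, hB⟩ := M.exists_pi_posterior_eq_map (N := N) hn s a
  let T : (Fin n → ℝ) → (Fin N → EuclideanSpace ℝ (Fin κ)) → Fin N → EuclideanSpace ℝ (Fin κ) :=
    fun z ξ l => M.postMean ⟨n, hn, s, z⟩ a + B (ξ l)
  have hT : Measurable (Function.uncurry T) :=
    measurable_pi_lambda _ fun l => ((M.measurable_postMean hn s a).comp measurable_fst).add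
      (B.measurable.comp ((measurable_pi_apply l).comp measurable_snd))
  have hTz : ∀ z, Measurable (T z) := fun z => hT.of_uncurry_left
  have hpi : ∀ z, Measure.pi (fun _ : Fin N => M.posterior ⟨n, hn, s, z⟩ a) =
      (Measure.pi fun _ : Fin N => stdGaussian (EuclideanSpace ℝ (Fin κ))).map (T z) :=
    fun z => hB z
  refine measure_mem_le_of_conditional (R := Measure.pi fun _ : Fin N =>
    stdGaussian (EuclideanSpace ℝ (Fin κ))) (ho'.mono (pathSigma_le hZ.measurable p) le_rfl)
    (measurable_pi_lambda (fun ω => Z ω p a) fun l => hZ.measurable p a l) hT ?_ hG ?_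
  · intro E V hE hV
    refine (hZ.condLaw p a hp hf (o ⁻¹' E) (ho' hE) V hV).trans ?_
    refine lintegral_congr fun ω => ?_
    rw [hnode, hpi, Measure.map_apply (hTz _) hV]
  · intro z
    have h := hb z
    rw [hpi, Measure.map_apply (hTz z) (measurable_prodMk_left hG)] at h
    exact h

/-- The tail bound given the data at the node is uniform in the measurements, so it survives
integration over the path. -/
lemma measure_node_deviation_le [MeasurableSpace Ω] {P : Measure Ω} [IsProbabilityMeasure P]
    (hκ : 0 < κ) (hN : 0 < N) {m₀ : ℕ} {d : History S} {Z : Ω → SampleTree S κ N}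
    (hZ : M.IsSampling P m₀ d Z) {p : List ((Fin κ → S) × Fin N)} {a : Fin κ → S}
    (hp : p.length < m₀) (hf : M.Feasible d (p.map Prod.fst ++ [a])) {f : History S → ℝ} {L : ℝ}
    (hL : 0 ≤ L) (hfL : M.EnergyLipschitz L f) {u : ℝ≥0} (hu : ∀ x, M.cov x x + M.noiseVar ≤ u)
    {ε : ℝ} (hε : 0 ≤ ε) :
    P {ω | ε < |1 / (N : ℝ) * ∑ l, f ((nodeData d (Z ω) p).extend a (Z ω p a l)) -
      ∫ y, f ((nodeData d (Z ω) p).extend a y) ∂(M.posterior (nodeData d (Z ω) p) a)|} ≤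
    ENNReal.ofReal (2 * Real.exp (-(N * ε ^ 2 /
      (2 * (2 * (L / √M.noiseVar).toNNReal ^ 2 * κ * u : ℝ≥0))))) := by
  obtain ⟨n, hn, s, o, ho, hnode⟩ := exists_nodeData_eq d Z p
  simp only [hnode]
  exact hZ.measure_mem_le hp hf hn s ho hnode
    (measurableSet_lt measurable_const
      (M.measurable_deviation hn s a (hfL.continuous_extend hL hn s a)))
    fun z => M.pi_posterior_deviation_le hκ hN ⟨n, hn, s, z⟩ a hL hfL hu hε

/-- Union bound by recursion on the depth: a failure is either a bad mean at the node, for one of at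
most `A` macro-actions, or a failure below one of at most `A * N` children. Only conditional laws
along single paths enter, so no independence between branches is needed. -/
lemma measure_not_accurate_le [MeasurableSpace Ω] {P : Measure Ω} {A : ℕ} (hA : 0 < A)
    (hN : 0 < N) (hcard : ∀ x, (M.actions x).card ≤ A) {m₀ : ℕ} {d : History S}
    {Z : Ω → SampleTree S κ N} {ε : ℝ} {b : ENNReal}
    (hb : ∀ (k : ℕ) (p : List ((Fin κ → S) × Fin N)) (a : Fin κ → S), k ≤ m₀ → p.length < m₀ →
      M.Feasible d (p.map Prod.fst ++ [a]) →
      P {ω | ε < |1 / (N : ℝ) * ∑ l, M.optV k ((nodeData d (Z ω) p).extend a (Z ω p a l)) -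
        ∫ y, M.optV k ((nodeData d (Z ω) p).extend a y)
          ∂(M.posterior (nodeData d (Z ω) p) a)|} ≤ b)
    (m : ℕ) (p : List ((Fin κ → S) × Fin N)) (hp : p.length + m ≤ m₀)
    (hf : M.Feasible d (p.map Prod.fst)) :
    P {ω | ¬ M.Accurate ε m (nodeData d (Z ω) p) (fun q => Z ω (p ++ q))} ≤
      m * (A * N : ℕ) ^ m * b := by
  induction m generalizing p with
  | zero => simp [Accurate]
  | succ m ih =>
    obtain ⟨n, hn, s, o, -, hnode⟩ := exists_nodeData_eq d Z p
    set acts := M.actions (s ⟨n - 1, Nat.sub_lt hn Nat.one_pos⟩) with hacts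
    have hcur : ∀ ω, M.actions (nodeData d (Z ω) p).current = acts := fun ω => by
      rw [hnode]; rfl
    -- Feasibility is a statement about locations only, but deducing it from the current location at
    -- the node requires some realization `ω₀` of the tree.
    rcases isEmpty_or_nonempty Ω with hΩ | ⟨⟨ω₀⟩⟩
    · rw [Measure.eq_zero_of_isEmpty P]; simp
    have hfa : ∀ a ∈ acts, M.Feasible d (p.map Prod.fst ++ [a]) := fun a ha =>
      hf.append_singleton (Z := Z ω₀) (by rw [hcur]; exact ha)
    have hsubset : {ω | ¬ M.Accurate ε (m + 1) (nodeData d (Z ω) p) (fun q => Z ω (p ++ q))} ⊆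
        ⋃ a ∈ acts, ({ω | ε < |1 / (N : ℝ) *
            ∑ l, M.optV (m + 1) ((nodeData d (Z ω) p).extend a (Z ω p a l)) -
          ∫ y, M.optV (m + 1) ((nodeData d (Z ω) p).extend a y)
            ∂(M.posterior (nodeData d (Z ω) p) a)|} ∪
          ⋃ l : Fin N, {ω | ¬ M.Accurate ε m (nodeData d (Z ω) (p ++ [(a, l)]))
            (fun q => Z ω ((p ++ [(a, l)]) ++ q))}) := by
      intro ω hω
      by_contra hcon
      refine hω fun a ha => ?_
      rw [hcur] at ha
      simp only [Set.mem_iUnion, Set.mem_union, Set.mem_ofPred_eq, not_exists, not_or, not_lt,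
        not_not] at hcon
      obtain ⟨h1, h2⟩ := hcon a ha
      refine ⟨by simpa only [List.append_nil] using h1, fun l => ?_⟩
      have := h2 l
      rw [nodeData_append_singleton] at this
      simp only [List.append_nil]
      simpa only [List.append_assoc, List.cons_append, List.nil_append] using this
    refine (measure_mono hsubset).trans ((measure_biUnion_finset_le _ _).trans ?_)
    have hA' : (1 : ENNReal) ≤ (A * N : ℕ) := by exact_mod_cast Nat.mul_pos hA hN
    calc ∑ a ∈ acts, P _ ≤ ∑ _a ∈ acts, (b + N * (m * (A * N : ℕ) ^ m * b)) := by
          refine Finset.sum_le_sum fun a ha => (measure_union_le _ _).trans (add_le_add ?_ ?_)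
          · exact hb (m + 1) p a (by omega) (by omega) (hfa a ha)
          · refine (measure_iUnion_fintype_le _ _).trans ?_
            refine (Finset.sum_le_sum fun l _ => ih (p ++ [(a, l)]) ?_ ?_).trans ?_
            · simp only [List.length_append, List.length_singleton]; omega
            · simpa using hfa a ha
            · simp
      _ ≤ A * (b + N * (m * (A * N : ℕ) ^ m * b)) := by
          rw [Finset.sum_const, nsmul_eq_mul]
          gcongr
          exact_mod_cast hcard _
      _ ≤ (A * N : ℕ) ^ (m + 1) * b + A * (N * (m * (A * N : ℕ) ^ m * b)) := by
          rw [mul_add]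
          gcongr
          calc (A : ENNReal) ≤ (A * N : ℕ) := by exact_mod_cast Nat.le_mul_of_pos_right A hN
            _ ≤ _ := le_self_pow hA' (by omega)
      _ = _ := by push_cast; ring

end Model

end MacroGPO

/-! ### The sample size and its growth -/

namespace MacroGPO

open scoped NNReal

section SampleSize

/-- The exponential is split into two halves. With `x = a * N / 2`, the bound `x ^ H ≤ H! * exp x`
lets one half absorb `(A * N) ^ H`; the logarithmic hypothesis makes the other half at most `δ / B`.
-/
lemma pow_mul_exp_neg_le {a δ : ℝ} (ha : 0 < a) (hδ : 0 < δ) {H A N : ℕ} (hH : 0 < H) (hA : 0 < A)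
    (hN : 2 / a * Real.log (2 * H * H.factorial * (2 * A / a) ^ H / δ) ≤ N) :
    2 * H * (A * N : ℝ) ^ H * Real.exp (-(a * N)) ≤ δ := by
  set B : ℝ := 2 * H * H.factorial * (2 * A / a) ^ H with hB
  have hB0 : 0 < B := by positivity
  set x : ℝ := a * N / 2 with hx
  have hx0 : 0 ≤ x := by positivity
  have h1 : x ^ H ≤ H.factorial * Real.exp x := by
    have := Real.pow_div_factorial_le_exp x hx0 H
    rwa [div_le_iff₀ (by positivity), mul_comm] at this
  have h2 : Real.log (B / δ) ≤ x := by
    rw [div_mul_eq_mul_div, div_le_iff₀ ha] at hN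
    rw [hx]
    linarith
  have h3 : B ≤ δ * Real.exp x := by
    have := (Real.log_le_iff_le_exp (by positivity)).1 h2
    rwa [div_le_iff₀ hδ, mul_comm] at this
  have h4 : (A * N : ℝ) = 2 * A / a * x := by rw [hx]; field_simp
  have h5 : Real.exp (-(a * N)) = Real.exp (-x) * Real.exp (-x) := by
    rw [← Real.exp_add, hx]; ring_nf
  have h6 : Real.exp x * Real.exp (-x) = 1 := by rw [← Real.exp_add]; simp
  rw [h4, mul_pow, h5]
  calc 2 * H * ((2 * A / a) ^ H * x ^ H) * (Real.exp (-x) * Real.exp (-x))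
      ≤ 2 * H * ((2 * A / a) ^ H * (H.factorial * Real.exp x)) *
          (Real.exp (-x) * Real.exp (-x)) := by gcongr
    _ = B * Real.exp (-x) * (Real.exp x * Real.exp (-x)) := by rw [hB]; ring
    _ ≤ δ * Real.exp x * Real.exp (-x) * (Real.exp x * Real.exp (-x)) := by gcongr
    _ = δ := by rw [mul_assoc δ, h6]; ring

/-- Exponential rate in the concentration bound. -/
noncomputable def rate (H : ℕ) (c : ℝ) (κ : ℕ) (lam : ℝ) : ℝ :=
  min lam 1 ^ 2 / (c * κ ^ (2 * H))

/-- A sufficient number of samples per macro-action at each node. -/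
noncomputable def sampleSize (H : ℕ) (c : ℝ) (κ A : ℕ) (δ lam : ℝ) : ℕ :=
  ⌈2 / rate H c κ lam *
    Real.log (2 * H * H.factorial * (2 * A / rate H c κ lam) ^ H / δ)⌉₊ + 1

/-- The argument of the logarithm is at most a constant times a fixed power of `κ * A / (δ * lam)`,
so its logarithm costs only constants. -/
lemma log_div_le {H : ℕ} (hH : 0 < H) {c : ℝ} (hc : 0 < c) {κ A : ℕ} (hκ : 0 < κ) (hA : 0 < A)
    {δ lam μ : ℝ} (hδ : 0 < δ) (hδ1 : δ < 1) (hlam : 0 < lam) (hμ : 1 ≤ μ) (hlμ : lam ≤ μ) :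
    Real.log (2 * H * H.factorial * (2 * A / rate H c κ lam) ^ H / δ) ≤
      Real.log (2 * H * H.factorial * (2 * c) ^ H) +
        (2 * H * H + 1 : ℕ) * (Real.log μ + Real.log (κ * A / (δ * lam))) := by
  have hκ1 : (1 : ℝ) ≤ κ := by exact_mod_cast hκ
  have hA1 : (1 : ℝ) ≤ A := by exact_mod_cast hA
  -- Truncation at 1 makes `1 / l` at least 1, so its powers may be raised to the common exponent `2
  -- * H`; the price is the factor `μ` in `hlm`.
  set l := min lam 1 with hl
  have hl0 : 0 < l := lt_min hlam one_pos
  have hl1 : l ≤ 1 := min_le_right _ _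
  have hlm : lam ≤ μ * l := by
    rw [hl, mul_min_of_nonneg _ _ (by linarith), mul_one]
    exact le_min (le_mul_of_one_le_left hlam.le hμ) hlμ
  set q := κ * A / (δ * l) with hq
  have hδl : δ * l ≤ 1 := mul_le_one₀ hδ1.le hl0.le hl1
  have hqδ : 1 / δ ≤ q := by
    rw [hq, div_le_div_iff₀ hδ (by positivity)]
    have : 1 ≤ (κ : ℝ) * A := one_le_mul_of_one_le_of_one_le hκ1 hA1
    nlinarith
  have hq0 : 0 < q := by positivity
  have hAκ : κ * A / l ≤ q := by
    rw [hq]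
    gcongr
    nlinarith
  have hq' : 1 ≤ q := le_trans (by rw [le_div_iff₀ hδ]; linarith) hqδ
  have h1 : A * κ ^ (2 * H) / l ^ 2 ≤ q ^ (2 * H) := by
    calc (A : ℝ) * κ ^ (2 * H) / l ^ 2 ≤ A ^ (2 * H) * κ ^ (2 * H) / l ^ (2 * H) := by
          have e1 : (A : ℝ) ≤ A ^ (2 * H) := le_self_pow₀ hA1 (by omega)
          have e2 : l ^ (2 * H) ≤ l ^ 2 := pow_le_pow_of_le_one hl0.le hl1 (by omega)
          gcongr
      _ = (κ * A / l) ^ (2 * H) := by rw [div_pow, mul_pow, mul_comm]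
      _ ≤ _ := by gcongr
  have hqm : q ≤ μ * (κ * A / (δ * lam)) := by
    rw [hq, mul_div_assoc', div_le_div_iff₀ (by positivity) (by positivity)]
    have : 0 ≤ (κ : ℝ) * A * δ := by positivity
    nlinarith [mul_le_mul_of_nonneg_left hlm this]
  have e : 2 * A / rate H c κ lam = 2 * c * (A * κ ^ (2 * H) / l ^ 2) := by
    unfold rate
    rw [← hl]
    field_simp
  have h2 : 2 * H * H.factorial * (2 * A / rate H c κ lam) ^ H / δ ≤
      2 * H * H.factorial * (2 * c) ^ H * (μ * (κ * A / (δ * lam))) ^ (2 * H * H + 1) := by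
    rw [e, mul_pow (2 * c), ← mul_assoc, mul_div_assoc]
    gcongr
    calc (A * κ ^ (2 * H) / l ^ 2) ^ H / δ = (A * κ ^ (2 * H) / l ^ 2) ^ H * (1 / δ) := by ring
      _ ≤ (q ^ (2 * H)) ^ H * q := by gcongr
      _ = q ^ (2 * H * H + 1) := by rw [← pow_mul, pow_succ]
      _ ≤ _ := by gcongr
  have hr0 : 0 < rate H c κ lam := by unfold rate; positivity
  refine (Real.log_le_log (by positivity) h2).trans (le_of_eq ?_)
  rw [Real.log_mul (by positivity) (by positivity), Real.log_pow,
    Real.log_mul (x := μ) (by positivity) (by positivity)]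

lemma sampleSize_le {H : ℕ} (hH : 0 < H) {c : ℝ} (hc : 0 < c) (lamMax : ℝ) {r : ℝ} (hr : 1 < r) :
    ∃ C : ℝ, 0 < C ∧ ∀ (κ A : ℕ) (δ lam : ℝ), 0 < κ → 0 < A → 0 < δ → δ < 1 → 0 < lam →
      lam ≤ lamMax → r ≤ (κ : ℝ) * A / (δ * lam) → (sampleSize H c κ A δ lam : ℝ) ≤
        C * ((κ : ℝ) ^ (2 * H) / lam ^ 2 * Real.log ((κ : ℝ) * A / (δ * lam))) := by
  set μ := max lamMax 1 with hμ
  have hμ1 : 1 ≤ μ := le_max_right _ _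
  have hlr : 0 < Real.log r := Real.log_pos hr
  have hlμ : 0 ≤ Real.log μ := Real.log_nonneg hμ1
  set D := |Real.log (2 * H * H.factorial * (2 * c) ^ H)| + (2 * H * H + 1 : ℕ) * Real.log μ with hD
  have hD0 : 0 ≤ D := by positivity
  set C₁ := D / Real.log r + (2 * H * H + 1 : ℕ) with hC₁
  have hC₁0 : 0 ≤ C₁ := by positivity
  refine ⟨2 * c * μ ^ 2 * C₁ + 2 * μ ^ 2 / Real.log r, by positivity, ?_⟩
  intro κ A δ lam hκ hA hδ hδ1 hlam hle hq
  have hκ1 : (1 : ℝ) ≤ κ := by exact_mod_cast hκ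
  set X := Real.log ((κ : ℝ) * A / (δ * lam)) with hX
  have hXr : Real.log r ≤ X := Real.log_le_log (by linarith) hq
  have hX0 : 0 < X := hlr.trans_le hXr
  have hlamμ : lam ≤ μ := hle.trans (le_max_left _ _)
  have hlog := log_div_le hH hc hκ hA hδ hδ1 hlam hμ1 hlamμ
  rw [← hX] at hlog
  have h1 : Real.log (2 * H * H.factorial * (2 * A / rate H c κ lam) ^ H / δ) ≤ C₁ * X := by
    refine hlog.trans ?_
    -- Additive constants are absorbed because `X` is bounded below by `log r > 0`.
    have h2 : D ≤ D / Real.log r * X := by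
      rw [div_mul_eq_mul_div, le_div_iff₀ hlr]
      gcongr
    have h3 := le_abs_self (Real.log (2 * H * H.factorial * (2 * c) ^ H))
    rw [hC₁, add_mul]
    linarith
  set l := min lam 1 with hl
  have hl0 : 0 < l := lt_min hlam one_pos
  have hlm : lam ≤ μ * l := by
    rw [hl, mul_min_of_nonneg _ _ (by linarith), mul_one]
    exact le_min (le_mul_of_one_le_left hlam.le hμ1) hlamμ
  have hr0 : 0 < rate H c κ lam := by unfold rate; positivity
  have hinv : 2 / rate H c κ lam ≤ 2 * c * μ ^ 2 * (κ ^ (2 * H) / lam ^ 2) := by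
    have e : 2 / rate H c κ lam = 2 * c * (κ ^ (2 * H) * (1 / l ^ 2)) := by
      unfold rate
      rw [← hl]
      field_simp
    have h2 : 1 / l ^ 2 ≤ μ ^ 2 / lam ^ 2 := by
      rw [div_le_div_iff₀ (by positivity) (by positivity), one_mul, ← mul_pow]
      gcongr
    rw [e]
    calc 2 * c * (κ ^ (2 * H) * (1 / l ^ 2)) ≤ 2 * c * (κ ^ (2 * H) * (μ ^ 2 / lam ^ 2)) := by
          gcongr
      _ = _ := by ring
  have hy : 2 / rate H c κ lam *
      Real.log (2 * H * H.factorial * (2 * A / rate H c κ lam) ^ H / δ) ≤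
      2 * c * μ ^ 2 * (κ ^ (2 * H) / lam ^ 2) * (C₁ * X) :=
    (mul_le_mul_of_nonneg_left h1 (by positivity)).trans
      (mul_le_mul_of_nonneg_right hinv (by positivity))
  have hceil : (⌈2 / rate H c κ lam *
      Real.log (2 * H * H.factorial * (2 * A / rate H c κ lam) ^ H / δ)⌉₊ : ℝ) ≤
      2 * c * μ ^ 2 * (κ ^ (2 * H) / lam ^ 2) * (C₁ * X) + 1 :=
    (Nat.cast_le.2 (Nat.ceil_mono hy)).trans (Nat.ceil_lt_add_one (by positivity)).le
  -- The 2 pays for rounding up and for the extra sample in `sampleSize`.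
  have htwo : 2 ≤ 2 * μ ^ 2 / Real.log r * (κ ^ (2 * H) / lam ^ 2 * X) := by
    have h2 : 1 ≤ μ ^ 2 * (κ ^ (2 * H) / lam ^ 2) := by
      rw [mul_div_assoc', le_div_iff₀ (by positivity), one_mul]
      calc lam ^ 2 ≤ μ ^ 2 * 1 := by rw [mul_one]; gcongr
        _ ≤ _ := by gcongr; exact one_le_pow₀ hκ1
    have h3 : 1 ≤ X / Real.log r := by rwa [le_div_iff₀ hlr, one_mul]
    calc (2 : ℝ) ≤ 2 * (μ ^ 2 * (κ ^ (2 * H) / lam ^ 2) * (X / Real.log r)) := by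
          nlinarith [one_le_mul_of_one_le_of_one_le h2 h3]
      _ = _ := by ring
  unfold sampleSize
  push_cast
  calc _ ≤ 2 * c * μ ^ 2 * (κ ^ (2 * H) / lam ^ 2) * (C₁ * X) + 1 + 1 := by gcongr
    _ ≤ 2 * c * μ ^ 2 * (κ ^ (2 * H) / lam ^ 2) * (C₁ * X) +
        2 * μ ^ 2 / Real.log r * (κ ^ (2 * H) / lam ^ 2 * X) := by linarith
    _ = _ := by ring

end SampleSize

/-! ### Assembly of the probability bound -/

namespace Model

variable {S Ω : Type*} {κ N : ℕ} (M : Model S κ)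

lemma EnergyLipschitz.mono {M : Model S κ} {K K' : ℝ} (h : K ≤ K') {f : History S → ℝ}
    (hf : M.EnergyLipschitz K f) : M.EnergyLipschitz K' f := fun n hn s z w =>
  (hf n hn s z w).trans (by gcongr)

lemma measure_not_accurate_root_le [MeasurableSpace Ω] {P : Measure Ω} [IsProbabilityMeasure P]
    {H A : ℕ} (hκ : 0 < κ) (hA : 0 < A) (hN : 0 < N) {v : ℝ} (hv0 : 0 ≤ v)
    (hv : ∀ x, M.cov x x ≤ v) (hcard : ∀ x, (M.actions x).card ≤ A) {m₀ : ℕ} (hm₀ : m₀ ≤ H)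
    {d : History S} {Z : Ω → SampleTree S κ N} (hZ : M.IsSampling P m₀ d Z) {ε : ℝ} (hε : 0 ≤ ε)
    {m : ℕ} (hm : m ≤ m₀) :
    P {ω | ¬ M.Accurate ε m d (Z ω)} ≤ ENNReal.ofReal (m * (A * N) ^ m *
      (2 * Real.exp (-(N * ε ^ 2 /
        (4 * H ^ 2 * v * (v + M.noiseVar) / M.noiseVar * κ ^ 3))))) := by
  have hs := M.noiseVar_pos
  set L : ℝ := H * κ * √v with hL
  have hL0 : 0 ≤ L := by positivity
  set u : ℝ≥0 := (v + M.noiseVar).toNNReal with hu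
  have hu' : (u : ℝ) = v + M.noiseVar := Real.coe_toNNReal _ (by positivity)
  -- The exponent of `κ ^ 3` has two sources: the squared Lipschitz constant gives `κ ^ 2`, and the
  -- variance proxy one more `κ`.
  have hc : (2 * (2 * (L / √M.noiseVar).toNNReal ^ 2 * κ * u : ℝ≥0) : ℝ) =
      4 * H ^ 2 * v * (v + M.noiseVar) / M.noiseVar * κ ^ 3 := by
    push_cast
    rw [hu', Real.coe_toNNReal _ (by positivity), div_pow, Real.sq_sqrt hs.le, hL, mul_pow, mul_pow,
      Real.sq_sqrt hv0]
    ring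
  have h := M.measure_not_accurate_le (P := P) hA hN hcard (m₀ := m₀) (d := d) (Z := Z) (ε := ε)
    (b := ENNReal.ofReal (2 * Real.exp (-(N * ε ^ 2 /
      (4 * H ^ 2 * v * (v + M.noiseVar) / M.noiseVar * κ ^ 3)))))
    (fun k p a hk hp hf => by
      have h1 : M.EnergyLipschitz L (M.optV k) := (M.energyLipschitz_optV hv k).mono (by
        rw [hL]
        have : (k : ℝ) ≤ H := by exact_mod_cast hk.trans hm₀
        gcongr)
      rw [← hc]
      exact M.measure_node_deviation_le hκ hN hZ hp hf hL0 h1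
        (fun x => by rw [hu']; linarith [hv x]) hε)
    m [] (by simpa using hm) trivial
  refine (le_of_eq ?_).trans (h.trans (le_of_eq ?_))
  · rfl
  · rw [ENNReal.ofReal_mul (p := m * (A * N) ^ m) (by positivity),
      ENNReal.ofReal_mul (p := m) (by positivity), ENNReal.ofReal_pow (by positivity), ENNReal.ofReal_natCast, ← Nat.cast_mul,
      ENNReal.ofReal_natCast]

end Model

end MacroGPO

theorem theorem1 (H : ℕ) (hH : 0 < H) (sigmaY2 sigmaN2 : ℝ) (hN : 0 < sigmaN2) :
    ∃ N₀ : ℕ → ℕ → ℝ → ℝ → ℕ,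
      (∀ κ A δ lam, 0 < N₀ κ A δ lam) ∧
      (∀ lamMax r : ℝ, 1 < r → ∃ C : ℝ, 0 < C ∧
        ∀ (κ A : ℕ) (δ lam : ℝ), 0 < κ → 0 < A → 0 < δ → δ < 1 → 0 < lam → lam ≤ lamMax →
          r ≤ (κ : ℝ) * A / (δ * lam) →
          (N₀ κ A δ lam : ℝ) ≤
            C * ((κ : ℝ) ^ (2 * H) / lam ^ 2 * Real.log ((κ : ℝ) * A / (δ * lam)))) ∧
      ∀ (κ A : ℕ) (δ lam : ℝ), 0 < κ → 0 < A → 0 < δ → δ < 1 → 0 < lam →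
        ∀ N : ℕ, N₀ κ A δ lam ≤ N →
        ∀ (S : Type*) (M : MacroGPO.Model S κ), M.noiseVar = sigmaN2 →
          (∀ s, M.cov s s ≤ sigmaY2) → (∀ s, (M.actions s).card ≤ A) →
        ∀ (t : ℕ), t < H → ∀ (d : MacroGPO.History S)
          (Ω : Type*) [MeasurableSpace Ω] (P : Measure Ω) [IsProbabilityMeasure P]
          (Z : Ω → MacroGPO.SampleTree S κ N), M.IsSampling P (H - t) d Z →
          ENNReal.ofReal (1 - δ) ≤
            P {ω | ∀ a ∈ M.actions d.current,
              |M.sampQ (H - (t + 1)) d (Z ω) a - M.optQ (H - (t + 1)) d a| ≤ lam * H} := by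
  -- No sign is assumed for `sigmaY2`; this upper bound is positive in every case, which makes `c`
  -- positive.
  set v : ℝ := |sigmaY2| + 1 with hv
  have hv0 : 0 < v := by positivity
  set c : ℝ := 4 * H ^ 2 * v * (v + sigmaN2) / sigmaN2 with hc
  have hc0 : 0 < c := by positivity
  refine ⟨MacroGPO.sampleSize H c, fun κ A δ lam => Nat.succ_pos _,
    fun lamMax r hr => MacroGPO.sampleSize_le hH hc0 lamMax hr, ?_⟩
  intro κ A δ lam hκ hA hδ hδ1 hlam N hN₀ S M hnoise hcov hcard t ht d Ω _ P _ Z hZ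
  have hNpos : 0 < N := (Nat.succ_pos _).trans_le hN₀
  set m := H - (t + 1) with hm
  set l := min lam 1 with hl
  have hl0 : 0 < l := lt_min hlam one_pos
  have hbad : P {ω | ¬ M.Accurate l m d (Z ω)} ≤ ENNReal.ofReal δ := by
    refine (M.measure_not_accurate_root_le hκ hA hNpos hv0.le
      (fun x => (hcov x).trans (by rw [hv]; linarith [le_abs_self sigmaY2])) hcard
      (Nat.sub_le H t) hZ hl0.le (m := m) (by omega)).trans (ENNReal.ofReal_le_ofReal ?_)
    rw [hnoise, ← hc]
    -- With no further stage nothing is sampled, and the bound is zero. Otherwise `H ≥ 2`, which is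
    -- what `κ ^ 3 ≤ κ ^ (2 * H)` needs below.
    rcases Nat.eq_zero_or_pos m with h0 | h0
    · rw [h0]; simpa using hδ.le
    have hrate : 0 < MacroGPO.rate H c κ lam := by unfold MacroGPO.rate; positivity
    have hmain := MacroGPO.pow_mul_exp_neg_le (A := A) (N := N) hrate hδ hH hA
      ((Nat.le_ceil _).trans (Nat.cast_le.2 ((Nat.le_succ _).trans hN₀)))
    refine le_trans ?_ hmain
    have hmH : (m : ℝ) ≤ H := by exact_mod_cast Nat.sub_le H (t + 1)
    have hAN : 1 ≤ (A * N : ℝ) := by exact_mod_cast Nat.mul_pos hA hNpos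
    have hκ1 : (1 : ℝ) ≤ κ := by exact_mod_cast hκ
    have hpow : (A * N : ℝ) ^ m ≤ (A * N : ℝ) ^ H := pow_le_pow_right₀ hAN (Nat.sub_le H (t + 1))
    have hexp : Real.exp (-(N * l ^ 2 / (c * κ ^ 3))) ≤
        Real.exp (-(MacroGPO.rate H c κ lam * N)) := by
      refine Real.exp_le_exp.2 (neg_le_neg ?_)
      unfold MacroGPO.rate
      rw [div_mul_eq_mul_div, mul_comm (N : ℝ)]
      have : (κ : ℝ) ^ 3 ≤ κ ^ (2 * H) := pow_le_pow_right₀ hκ1 (by omega)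
      gcongr
    calc (m : ℝ) * (A * N) ^ m * (2 * Real.exp (-(N * l ^ 2 / (c * κ ^ 3))))
        ≤ H * (A * N) ^ H * (2 * Real.exp (-(MacroGPO.rate H c κ lam * N))) := by gcongr
      _ = _ := by ring
  set good := {ω | ∀ a ∈ M.actions d.current,
    |M.sampQ m d (Z ω) a - M.optQ m d a| ≤ lam * H} with hgood
  have hcover : (Set.univ : Set Ω) ⊆ good ∪ {ω | ¬ M.Accurate l m d (Z ω)} := by
    intro ω _
    by_cases hω : M.Accurate l m d (Z ω)
    · left
      intro a ha
      refine (hω.abs_sampQ_sub_optQ_le hl0.le ha).trans ?_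
      rw [mul_comm]
      have hmH : (m : ℝ) ≤ H := by exact_mod_cast Nat.sub_le H (t + 1)
      have := min_le_left lam 1
      gcongr
    · right; exact hω
  have h1 : (1 : ENNReal) ≤ P good + ENNReal.ofReal δ := by
    calc (1 : ENNReal) = P Set.univ := measure_univ.symm
      _ ≤ _ := (measure_mono hcover).trans (measure_union_le _ _)
      _ ≤ _ := by gcongr
  rw [ENNReal.ofReal_sub _ hδ.le, ENNReal.ofReal_one]
  exact tsub_le_iff_right.2 h1
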